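/- Fix $\beta>0$ (for instance $\beta\in\{1,2,4\}$). Let $\gamma(dx)=(\beta/2\pi)^{1/2}e^{-\beta x^2/2}\,dx$ on $\mathbb R$, let $B=\frac12\frac{\partial^2}{\partial x^2}-\frac{\beta x}{2}\frac{\partial}{\partial x}$ be the Ornstein–Uhlenbeck generator reversible with respect to $\gamma$, and let $e^{tB}$ be its semigroup, that is, $(e^{tB}f)(x)=\mathbb E f\big(e^{-\beta t/2}x+\sqrt{1-e^{-\beta t}}\,Z\big)$ with $Z$ distributed according to $\gamma$. On $\mathbb R^n$ let $\mathcal B$ be the sum of the copies of $B$ acting on the $n$ coordinates, so that $e^{t\mathcal B}=(e^{tB})^{\otimes n}$. Call $f\ge 0$ a *normalized density* if $f\gamma$ is a probability measure with mean zero and variance $1/\beta$. A measure $\nu$ on $\mathbb R$ satisfies the logarithmic Sobolev inequality with constant $c$ if $$\int h\log h\,d\nu\le c\int |(\sqrt h)'|^2\,d\nu$$ for every $h\ge 0$ with $\int h\,d\nu=1$ and $\sqrt h$ locally absolutely continuous. **Proposition.** Let $K\ge 1$ be an integer and let $C_1,C_2,M\in\mathbb R$, $\delta_0,a>0$. There are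 constants $\alpha>0$ and $C>0$, and for every $c\in\mathbb R$ a constant $D_c>0$, all depending only on $\beta,K,C_1,C_2,\delta_0,a,M$ (and $D_c$ also on $c$), such that the following holds. Let $u=e^{-V}$ be a normalized density with $V\in C^{2K}(\mathbb R)$, $$\sum_{j=1}^{2K}|V^{(j)}(x)|\le C_1(1+x^2)^{C_2}\quad (x\in\mathbb R),\qquad \int e^{\delta_0|x|^{a}}\,u\,d\gamma\le M .$$ Then for every $0\le t\le\alpha$ there is a normalized density $g_t$ such that: 1. $e^{tB}g_t-u\in L^1(\gamma)$ and $\displaystyle\int|e^{tB}g_t-u|\,d\gamma\le C\,t^K$. 2. For every $c>0$: if $u\gamma$ satisfies the logarithmic Sobolev inequality with constant $c$, then $g_t\gamma$ satisfies it with constant $2c$; and if $g_t\gamma$ satisfies it with constant $c$, then $u\gamma$ satisfies it with constant $2c$. 3. For all $c\in\mathbb R$ and all integers $n,N\ge 0$ with $n\le cN^2$, with $G_t=g_t^{\otimes n}$ and $F=u^{\otimes n}$, one has $e^{t\mathcal B}G_t-F\in L^1(\gamma^{\otimes n})$ and $$\int|e^{t\mathcal B}G_t-F|\,d\gamma^{\otimes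 n}\le D_c\,N^2\,t^K .$$ -/

import Mathlib

open MeasureTheory ProbabilityTheory

noncomputable section

/-- The generator `B = (1/2) ∂² - (β x / 2) ∂` of the Ornstein-Uhlenbeck process on the line. -/
def ouGenerator (β : ℝ) (f : ℝ → ℝ) (x : ℝ) : ℝ :=
  1 / 2 * deriv (deriv f) x - β * x / 2 * deriv f x

/-- The reversible measure `γ(dx) = (β / 2π)^(1/2) exp (-β x² / 2) dx`, that is, the centered
Gaussian measure of variance `1 / β`. -/
def gaussMeasure (β : ℝ) : Measure ℝ :=
  gaussianReal 0 (1 / β).toNNReal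

/-- The law at time `t` of the process with generator `B` started at `x`
(the solution of `dX = dW - (β / 2) X dt`, `X 0 = x`): the Gaussian measure with
mean `exp (-β t / 2) x` and variance `(1 - exp (-β t)) / β`. -/
def ouKernel (β t x : ℝ) : Measure ℝ :=
  gaussianReal (Real.exp (-β * t / 2) * x) ((1 - Real.exp (-β * t)) / β).toNNReal

/-- The semigroup `exp (t B)` of the generator `B`, in one variable. -/
def ouSemigroup (β t : ℝ) (f : ℝ → ℝ) (x : ℝ) : ℝ :=
  ∫ y, f y ∂(ouKernel β t x)

/-- The semigroup `exp (t 𝓑)` in `n` variables, where `𝓑` is the sum of the `n` copies of `B`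
acting on the separate coordinates: the coordinates evolve independently. -/
def ouSemigroupPi (β t : ℝ) {n : ℕ} (f : (Fin n → ℝ) → ℝ) (x : Fin n → ℝ) : ℝ :=
  ∫ y, f y ∂(Measure.pi fun i => ouKernel β t (x i))

/-- The tensor power `f^(⊗ n)`. -/
def tensorPow (n : ℕ) (f : ℝ → ℝ) (x : Fin n → ℝ) : ℝ :=
  ∏ i, f (x i)

/-- The measure `f γ` on the line. -/
def densityMeasure (β : ℝ) (f : ℝ → ℝ) : Measure ℝ :=
  (gaussMeasure β).withDensity fun x => ENNReal.ofReal (f x)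

/-- `f` is a probability density with respect to `γ`, and the probability measure `f γ` has
mean zero and variance `1 / β`. -/
structure IsNormalizedDensity (β : ℝ) (f : ℝ → ℝ) : Prop where
  measurable : Measurable f
  nonneg : ∀ x, 0 ≤ f x
  isProb : IsProbabilityMeasure (densityMeasure β f)
  memLp : MemLp (fun x : ℝ => x) 2 (densityMeasure β f)
  mean : ∫ x, x ∂(densityMeasure β f) = 0
  variance : variance (fun x : ℝ => x) (densityMeasure β f) = 1 / β

/-- The logarithmic Sobolev inequality with constant `c` for a measure on the line:
`∫ h log h dν ≤ c ∫ |(√h)'|² dν` for every probability density `h` with respect to `ν` whose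
square root is locally absolutely continuous. When the right side is infinite, nothing is
claimed; when it is finite, the left side is required to be finite as well. -/
def LogSobolev (ν : Measure ℝ) (c : ℝ) : Prop :=
  ∀ h : ℝ → ℝ, (∀ x, 0 ≤ h x) → Integrable h ν → ∫ x, h x ∂ν = 1 →
    (∀ a b, AbsolutelyContinuousOnInterval (fun x => √(h x)) a b) →
    Integrable (fun x => deriv (fun z => √(h z)) x ^ 2) ν →
    Integrable (fun x => h x * Real.log (h x)) ν ∧
      ∫ x, h x * Real.log (h x) ∂ν ≤ c * ∫ x, deriv (fun z => √(h z)) x ^ 2 ∂ν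

/-- The transition density solves `∂_t q = B q` in the variables `(t, x)`, so that
`ouSemigroup` is generated by `ouGenerator`. -/
theorem hasDerivAt_ouKernel_density (β t x y : ℝ) (hβ : 0 < β) (ht : 0 < t) :
    HasDerivAt
      (fun s => gaussianPDFReal (Real.exp (-β * s / 2) * x)
        ((1 - Real.exp (-β * s)) / β).toNNReal y)
      (ouGenerator β (fun z => gaussianPDFReal (Real.exp (-β * t / 2) * z)
        ((1 - Real.exp (-β * t)) / β).toNNReal y) x) t := by
  have hpos : ∀ s : ℝ, 0 < s → 0 < (1 - Real.exp (-β * s)) / β := fun s hs =>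
    div_pos (sub_pos.2 (Real.exp_lt_one_iff.2 (by nlinarith))) hβ
  have hv := hpos t ht
  set v := (1 - Real.exp (-β * t)) / β with hvdef
  set e := Real.exp (-β * t / 2) with he
  have hee : Real.exp (-β * t) = e ^ 2 := by
    rw [he, ← Real.exp_nat_mul]; congr 1; push_cast; ring
  -- spatial derivatives
  have h1 : ∀ z : ℝ, HasDerivAt (fun z => gaussianPDFReal (e * z) v.toNNReal y)
      (gaussianPDFReal (e * z) v.toNNReal y * (e * (y - e * z) / v)) z := by
    intro z
    simp only [gaussianPDFReal, Real.coe_toNNReal v hv.le]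
    have := ((((((hasDerivAt_id z).const_mul e).const_sub y).pow 2).neg.div_const
      (2 * v)).exp).const_mul ((√(2 * Real.pi * v))⁻¹)
    refine this.congr_deriv ?_
    simp only [id]
    field_simp
    simp
    ring_nf
  have hd : deriv (fun z => gaussianPDFReal (e * z) v.toNNReal y) =
      fun z => gaussianPDFReal (e * z) v.toNNReal y * (e * (y - e * z) / v) :=
    funext fun z => (h1 z).deriv
  have h2 : HasDerivAt (fun z => gaussianPDFReal (e * z) v.toNNReal y * (e * (y - e * z) / v))
      (gaussianPDFReal (e * x) v.toNNReal y * ((e * (y - e * x) / v) ^ 2 - e ^ 2 / v)) x := by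
    have := (h1 x).mul (((((hasDerivAt_id x).const_mul e).const_sub y).const_mul e).div_const v)
    refine this.congr_deriv ?_
    simp only [id]
    field_simp
    ring
  rw [ouGenerator, hd, h2.deriv]
  -- time derivative
  have hE : HasDerivAt (fun s : ℝ => Real.exp (-β * s / 2)) (e * (-β / 2)) t := by
    refine ((((hasDerivAt_id t).const_mul (-β)).div_const 2).exp).congr_deriv ?_
    simp [he]
  have hV : HasDerivAt (fun s : ℝ => (1 - Real.exp (-β * s)) / β) (e ^ 2) t := by
    refine (((((hasDerivAt_id t).const_mul (-β)).exp).const_sub 1).div_const β).congr_deriv ?_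
    simp only [id, mul_one]
    rw [hee]
    field_simp
  have hsq : HasDerivAt (fun s : ℝ => (√(2 * Real.pi * ((1 - Real.exp (-β * s)) / β)))⁻¹)
      ((√(2 * Real.pi * v))⁻¹ * (-(e ^ 2) / (2 * v))) t := by
    have hp : 0 < 2 * Real.pi * v := by positivity
    have := ((hV.const_mul (2 * Real.pi)).sqrt hp.ne').inv (Real.sqrt_pos.2 hp).ne'
    refine this.congr_deriv ?_
    rw [← hvdef, Real.sq_sqrt hp.le]
    have := Real.pi_pos
    have := Real.sqrt_pos.2 hp
    field_simp
  have hX : HasDerivAt (fun s : ℝ => Real.exp (-(y - Real.exp (-β * s / 2) * x) ^ 2 /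
      (2 * ((1 - Real.exp (-β * s)) / β))))
      (Real.exp (-(y - e * x) ^ 2 / (2 * v)) *
        ((y - e * x) ^ 2 * e ^ 2 / (2 * v ^ 2) - (y - e * x) * e * x * β / (2 * v))) t := by
    have := (((((hE.mul_const x).const_sub y).pow 2).neg).div (hV.const_mul 2)
      (by rw [← hvdef]; positivity)).exp
    refine this.congr_deriv ?_
    simp only [Pi.neg_apply, Pi.pow_apply, Pi.div_apply, ← hvdef, ← he]
    field_simp
    simp
    ring
  have hT := hsq.mul hX
  refine (hT.congr_of_eventuallyEq ?_).congr_deriv ?_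
  · filter_upwards [lt_mem_nhds ht] with s hs
    simp only [gaussianPDFReal, Real.coe_toNNReal _ (hpos s hs).le, Pi.mul_apply]
  · simp only [gaussianPDFReal, Real.coe_toNNReal v hv.le, ← hvdef, ← he]
    field_simp
    ring

end

/-!
The approximate preimage of `u = exp (-V)` under `e^{tB}` is the truncated exponential series
`∑_{k < K} (-t)ᵏ / k! Bᵏ u`, made into a probability density.

*The series.* Conjugating `B` by the weight gives `Bᵏ u = Pₖ u`, where `Pₖ` is a polynomial in `x`
and the derivatives of `V` up to order `2k` (`genFactor`). All `Pₖ`, `k ≤ K`, are bounded by one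
`A (1 + x²) ^ m` for the whole class of potentials (`UniformPolyGrowth`), and the exponential moment
bounds all polynomial moments of `u γ`, so `∫ |Bᴷ u| dγ` is uniformly bounded. For a bounded test
function `ψ` put `Jₖ(s) = ∫ (e^{sB} ψ) Bᵏ u dγ`. By the backward equation and the symmetry of `B`,
`Jₖ' = Jₖ₊₁`, so `∑_{k < K} (-s)ᵏ / k! Jₖ(s)` has derivative `(-s) ^ (K - 1) / (K - 1)! J_K(s)`,
and its values at `s = t` and `s = 0` differ by at most `t ^ K ∫ |Bᴷ u| dγ`. Taking the supremum
over `ψ` gives the `L¹` estimate (`abs_integral_inverse_expansion_sub_le`,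
`integral_abs_ouSemigroup_sub_le`). Only derivatives of test functions under the semigroup are
needed, and `u` itself is never differentiated under it.

*The density.* Write the series as `u (1 + Q)`, `|Q| ≤ κ t (1 + x²) ^ m`. Where
`√t (1 + x²) ^ m ≤ 1`, `Q` is `O(√t)`; elsewhere `1 ≤ t ^ K (1 + x²) ^ (2 K m)`, so that cutting
`Q` off there costs `O(t ^ K)` in `L¹`, even with a quadratic weight. The series has the same mass,
mean and second moment as `u`, because `B` preserves the span of `1, x, x²`; hence the cut-off
function misses them by `O(t ^ K)`. They are restored by a relative perturbation of size `O(t ^ K)`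
supported in `[-1, 1]`, where `u` is bounded below uniformly (`exists_lower_bound`,
`exists_moment_corrector`). The result `g` satisfies `2/3 u ≤ g ≤ 4/3 u` for small `t`
(`exists_normalizedDensity_near_expansion`).

*Consequences.* The two-sided bound and the Holley-Stroock argument (`LogSobolev.of_le_smul`)
transfer the logarithmic Sobolev inequality in both directions with a factor at most
`4/3 * 3/2 = 2`. In `n` variables the `L¹` error is at most `n` times the error in one variable
(`integral_abs_prod_sub_prod_le`), as `e^{tB} g` and `u` are probability densities.
-/

noncomputable section

variable {β : ℝ}

/-! ### Mehler's formula and reversibility -/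

instance instIsProbabilityMeasureGaussMeasure : IsProbabilityMeasure (gaussMeasure β) := by
  unfold gaussMeasure; infer_instance

instance instIsProbabilityMeasureOuKernel (t x : ℝ) : IsProbabilityMeasure (ouKernel β t x) := by
  unfold ouKernel; infer_instance

/-- The factor `exp (-β t / 2)` by which the Ornstein-Uhlenbeck flow contracts the mean. -/
def ouContraction (β t : ℝ) : ℝ := Real.exp (-β * t / 2)

/-- The factor `√(1 - exp (-β t))` in front of the Gaussian noise in Mehler's formula. -/
def ouNoise (β t : ℝ) : ℝ := √(1 - Real.exp (-β * t))

theorem ouContraction_pos (t : ℝ) : 0 < ouContraction β t := Real.exp_pos _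

theorem ouContraction_sq (t : ℝ) : ouContraction β t ^ 2 = Real.exp (-β * t) := by
  rw [ouContraction, ← Real.exp_nat_mul]; congr 1; push_cast; ring

theorem ouContraction_le_one (hβ : 0 < β) {t : ℝ} (ht : 0 ≤ t) : ouContraction β t ≤ 1 :=
  Real.exp_le_one_iff.2 (by nlinarith [mul_nonneg hβ.le ht])

theorem exp_neg_mul_le_one (hβ : 0 < β) {t : ℝ} (ht : 0 ≤ t) : Real.exp (-β * t) ≤ 1 :=
  Real.exp_le_one_iff.2 (by nlinarith [mul_nonneg hβ.le ht])

theorem ouNoise_sq (hβ : 0 < β) {t : ℝ} (ht : 0 ≤ t) :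
    ouNoise β t ^ 2 = 1 - Real.exp (-β * t) :=
  Real.sq_sqrt (sub_nonneg.2 (exp_neg_mul_le_one hβ ht))

theorem ouNoise_pos (hβ : 0 < β) {t : ℝ} (ht : 0 < t) : 0 < ouNoise β t :=
  Real.sqrt_pos.2 (sub_pos.2 (Real.exp_lt_one_iff.2 (by nlinarith)))

theorem ouKernel_eq_map (hβ : 0 < β) {t : ℝ} (ht : 0 ≤ t) (x : ℝ) :
    ouKernel β t x =
      (gaussMeasure β).map (fun z => ouContraction β t * x + ouNoise β t * z) := by
  have : (fun z => ouContraction β t * x + ouNoise β t * z) =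
      (fun z => ouContraction β t * x + z) ∘ fun z => ouNoise β t * z := rfl
  rw [this, ← Measure.map_map (by fun_prop) (by fun_prop), gaussMeasure,
    gaussianReal_map_const_mul, gaussianReal_map_const_add, ouKernel]
  congr 1
  · simp [ouContraction]
  · ext
    have h := exp_neg_mul_le_one hβ ht
    rw [Real.coe_toNNReal _ (div_nonneg (sub_nonneg.2 h) hβ.le)]
    simp only [NNReal.coe_mul, NNReal.coe_mk]
    rw [Real.coe_toNNReal _ (by positivity), ouNoise_sq hβ ht]
    ring

/-- Mehler's formula. -/
theorem ouSemigroup_eq_integral (hβ : 0 < β) {t : ℝ} (ht : 0 ≤ t) {f : ℝ → ℝ}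
    (hf : Measurable f) (x : ℝ) :
    ouSemigroup β t f x =
      ∫ z, f (ouContraction β t * x + ouNoise β t * z) ∂(gaussMeasure β) := by
  rw [ouSemigroup, ouKernel_eq_map hβ ht, integral_map (by fun_prop) hf.aestronglyMeasurable]

/-- The reflection that exchanges the endpoints of a stationary Ornstein-Uhlenbeck path: it maps
the start `x` and the noise `z` to the end point and the noise of the reversed path. -/
theorem measurePreserving_reflection (hβ : 0 < β) {t : ℝ} (ht : 0 ≤ t) :
    MeasurePreserving (fun p : ℝ × ℝ =>
      (ouContraction β t * p.1 + ouNoise β t * p.2, ouNoise β t * p.1 - ouContraction β t * p.2))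
      ((gaussMeasure β).prod (gaussMeasure β)) ((gaussMeasure β).prod (gaussMeasure β)) := by
  have hG : IsGaussian (gaussMeasure β) := by unfold gaussMeasure; infer_instance
  have h0 : (gaussMeasure β)[id] = 0 := by
    simp [gaussMeasure, integral_id_gaussianReal]
  have hc1 := ouContraction_le_one hβ ht
  have hc0 := ouContraction_pos (β := β) t
  have h1 := IsGaussian.map_rotation_eq_self h0 (Real.arccos (ouContraction β t))
  have hrot : MeasurePreserving (ContinuousLinearMap.rotation (E := ℝ)
      (Real.arccos (ouContraction β t)))
      ((gaussMeasure β).prod (gaussMeasure β)) ((gaussMeasure β).prod (gaussMeasure β)) :=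
    ⟨by fun_prop, h1⟩
  have hneg : MeasurePreserving (fun z : ℝ => -z) (gaussMeasure β) (gaussMeasure β) :=
    ⟨by fun_prop, by simp [gaussMeasure, gaussianReal_map_neg]⟩
  have h2 := ((MeasurePreserving.id (gaussMeasure β)).prod hneg).comp hrot
  convert h2 using 2 with p
  have hs : Real.sin (Real.arccos (ouContraction β t)) = ouNoise β t := by
    rw [Real.sin_arccos, ouContraction_sq, ouNoise]
  simp only [Function.comp, ContinuousLinearMap.rotation_apply, hs,
    Real.cos_arccos (by linarith) hc1, Prod.map, id, smul_eq_mul]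
  ext
  · simp
  · simp; ring

/-- Under `γ ⊗ γ` the start and the end of the path are exchangeable; this is the reversibility
of the semigroup with respect to `γ`. -/
theorem integrable_and_integral_mehler_swap (hβ : 0 < β) {t : ℝ} (ht : 0 ≤ t) {f χ : ℝ → ℝ}
    (hf : Integrable f (gaussMeasure β)) (hfm : Measurable f) (hχm : Measurable χ) {A : ℝ}
    (hχ : ∀ x, |χ x| ≤ A) :
    Integrable (fun p : ℝ × ℝ => χ p.1 * f (ouContraction β t * p.1 + ouNoise β t * p.2))
        ((gaussMeasure β).prod (gaussMeasure β)) ∧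
      ∫ p : ℝ × ℝ, χ p.1 * f (ouContraction β t * p.1 + ouNoise β t * p.2)
          ∂((gaussMeasure β).prod (gaussMeasure β)) =
        ∫ p : ℝ × ℝ, χ (ouContraction β t * p.1 + ouNoise β t * p.2) * f p.1
          ∂((gaussMeasure β).prod (gaussMeasure β)) := by
  have hT := measurePreserving_reflection hβ ht
  have hcs : ouContraction β t ^ 2 + ouNoise β t ^ 2 = 1 := by
    rw [ouContraction_sq, ouNoise_sq hβ ht]; ring
  set c := ouContraction β t
  set s := ouNoise β t
  have hm : Measurable (fun p : ℝ × ℝ => χ (c * p.1 + s * p.2) * f p.1) := by fun_prop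
  have hi : Integrable (fun p : ℝ × ℝ => χ (c * p.1 + s * p.2) * f p.1)
      ((gaussMeasure β).prod (gaussMeasure β)) := by
    refine Integrable.bdd_mul (c := A) (hf.comp_fst _) ?_ (ae_of_all _ fun p => ?_)
    · exact (hχm.comp (by fun_prop)).aestronglyMeasurable
    · simpa using hχ _
  have heq : (fun p : ℝ × ℝ => χ p.1 * f (c * p.1 + s * p.2)) =
      (fun p : ℝ × ℝ => χ (c * p.1 + s * p.2) * f p.1) ∘
        fun p : ℝ × ℝ => (c * p.1 + s * p.2, s * p.1 - c * p.2) := by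
    funext p
    simp only [Function.comp]
    congr 2
    linear_combination (-p.1) * hcs
  constructor
  · rw [heq]; exact hT.integrable_comp_of_integrable hi
  · rw [heq]
    have := integral_map (μ := (gaussMeasure β).prod (gaussMeasure β)) hT.measurable.aemeasurable
      (f := fun p : ℝ × ℝ => χ (c * p.1 + s * p.2) * f p.1)
      (by rw [hT.map_eq]; exact hm.aestronglyMeasurable)
    rw [hT.map_eq] at this
    exact this.symm

theorem integrable_ouSemigroup (hβ : 0 < β) {t : ℝ} (ht : 0 ≤ t) {f : ℝ → ℝ}
    (hf : Integrable f (gaussMeasure β)) (hfm : Measurable f) :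
    Integrable (ouSemigroup β t f) (gaussMeasure β) := by
  have h := (integrable_and_integral_mehler_swap hβ ht hf hfm (χ := fun _ => 1) measurable_const
    (A := 1) (by simp)).1.integral_prod_left
  refine h.congr (ae_of_all _ fun x => ?_)
  simp [ouSemigroup_eq_integral hβ ht hfm]

/-- Reversibility: the semigroup is symmetric in `L²(γ)`, here in the `L¹`-`L^∞` pairing. -/
theorem integral_mul_ouSemigroup (hβ : 0 < β) {t : ℝ} (ht : 0 ≤ t) {f χ : ℝ → ℝ}
    (hf : Integrable f (gaussMeasure β)) (hfm : Measurable f) (hχm : Measurable χ) {A : ℝ}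
    (hχ : ∀ x, |χ x| ≤ A) :
    ∫ x, χ x * ouSemigroup β t f x ∂(gaussMeasure β) =
      ∫ x, ouSemigroup β t χ x * f x ∂(gaussMeasure β) := by
  obtain ⟨h1, h2⟩ := integrable_and_integral_mehler_swap hβ ht hf hfm hχm hχ
  rw [integral_prod _ h1, integral_prod] at h2
  · simpa only [integral_const_mul, integral_mul_const, ← ouSemigroup_eq_integral hβ ht hfm,
      ← ouSemigroup_eq_integral hβ ht hχm] using h2
  · refine Integrable.bdd_mul (c := A) (hf.comp_fst _) ?_ (ae_of_all _ fun p => ?_)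
    · exact (hχm.comp (by fun_prop)).aestronglyMeasurable
    · simpa using hχ _

theorem abs_ouSemigroup_le {t : ℝ} {χ : ℝ → ℝ} {A : ℝ} (hχ : ∀ x, |χ x| ≤ A) (x : ℝ) :
    |ouSemigroup β t χ x| ≤ A := by
  have := norm_integral_le_of_norm_le_const (μ := ouKernel β t x) (f := χ) (C := A)
    (ae_of_all _ (by simpa using hχ))
  simpa [ouSemigroup] using this

theorem integral_ouSemigroup (hβ : 0 < β) {t : ℝ} (ht : 0 ≤ t) {f : ℝ → ℝ}
    (hf : Integrable f (gaussMeasure β)) (hfm : Measurable f) :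
    ∫ x, ouSemigroup β t f x ∂(gaussMeasure β) = ∫ x, f x ∂(gaussMeasure β) := by
  have := integral_mul_ouSemigroup hβ ht hf hfm (χ := fun _ => 1) measurable_const (A := 1) (by simp)
  simpa [ouSemigroup] using this

theorem ouSemigroup_nonneg {t : ℝ} {f : ℝ → ℝ} (hf : ∀ x, 0 ≤ f x) (x : ℝ) :
    0 ≤ ouSemigroup β t f x :=
  integral_nonneg hf

/-! ### Integration by parts under the Gaussian measure -/

/-- The Lebesgue density of `γ`. -/
def gaussPDF (β x : ℝ) : ℝ := gaussianPDFReal 0 (1 / β).toNNReal x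

theorem gaussPDF_pos (hβ : 0 < β) (x : ℝ) : 0 < gaussPDF β x :=
  gaussianPDFReal_pos _ _ _ (by simpa using hβ)

theorem measurable_gaussPDF : Measurable (gaussPDF β) := measurable_gaussianPDFReal _ _

theorem hasDerivAt_gaussPDF (hβ : 0 < β) (x : ℝ) :
    HasDerivAt (gaussPDF β) (-(β * x) * gaussPDF β x) x := by
  have hv : ((1 / β).toNNReal : ℝ) = 1 / β := Real.coe_toNNReal _ (by positivity)
  have h : gaussPDF β = fun x => (√(2 * Real.pi * (1 / β)))⁻¹ *
      Real.exp (-(x ^ 2) / (2 * (1 / β))) := by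
    funext y
    simp only [gaussPDF, gaussianPDFReal, hv, sub_zero]
  rw [h]
  have := ((((hasDerivAt_id x).pow 2).neg.div_const (2 * (1 / β))).exp).const_mul
    (√(2 * Real.pi * (1 / β)))⁻¹
  refine this.congr_deriv ?_
  simp only [id, Pi.neg_apply, Pi.pow_apply]
  field_simp
  ring_nf

theorem integral_gaussMeasure (hβ : 0 < β) (f : ℝ → ℝ) :
    ∫ x, f x ∂(gaussMeasure β) = ∫ x, gaussPDF β x * f x := by
  rw [gaussMeasure, integral_gaussianReal_eq_integral_smul (by simpa using hβ)]
  rfl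

theorem integrable_gaussMeasure_iff (hβ : 0 < β) {f : ℝ → ℝ} :
    Integrable f (gaussMeasure β) ↔ Integrable (fun x => gaussPDF β x * f x) := by
  rw [gaussMeasure, gaussianReal_of_var_ne_zero _ (by simpa using hβ),
    integrable_withDensity_iff_integrable_smul' (measurable_gaussianPDF _ _)
      (ae_of_all _ fun _ => gaussianPDF_lt_top)]
  simp only [toReal_gaussianPDF, smul_eq_mul]
  rfl

/-- Integration by parts for `γ`: the adjoint of `d/dx` is `β x - d/dx`. -/
theorem integral_deriv_mul_gaussMeasure (hβ : 0 < β) {φ φ' f f' : ℝ → ℝ}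
    (hφ : ∀ x, HasDerivAt φ (φ' x) x) (hf : ∀ x, HasDerivAt f (f' x) x)
    (h₁ : Integrable (fun x => φ' x * f x) (gaussMeasure β))
    (h₂ : Integrable (fun x => φ x * (x * f x)) (gaussMeasure β))
    (h₃ : Integrable (fun x => φ x * f' x) (gaussMeasure β))
    (h₄ : Integrable (fun x => φ x * f x) (gaussMeasure β)) :
    ∫ x, φ' x * f x ∂(gaussMeasure β) =
      ∫ x, φ x * (β * x * f x - f' x) ∂(gaussMeasure β) := by
  have h₅ : Integrable (fun x => φ x * (β * x * f x - f' x)) (gaussMeasure β) := by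
    refine ((h₂.const_mul β).sub h₃).congr (ae_of_all _ fun x => ?_)
    simp only [Pi.sub_apply]; ring
  rw [integrable_gaussMeasure_iff hβ] at h₁ h₄ h₅
  have key := integral_mul_deriv_eq_deriv_mul_of_integrable (u := fun x => gaussPDF β x * f x)
    (v := φ) (u' := fun x => -(β * x) * gaussPDF β x * f x + gaussPDF β x * f' x) (v' := φ')
    (fun x _ => (hasDerivAt_gaussPDF hβ x).mul (hf x)) (fun x _ => hφ x)
    (h₁.congr (ae_of_all _ fun x => by simp only [Pi.mul_apply]; ring))
    (h₅.neg.congr (ae_of_all _ fun x => by simp only [Pi.mul_apply, Pi.neg_apply]; ring))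
    (h₄.congr (ae_of_all _ fun x => by simp only [Pi.mul_apply]; ring))
  rw [integral_gaussMeasure hβ, integral_gaussMeasure hβ, ← integral_neg] at *
  calc _ = ∫ x, gaussPDF β x * f x * φ' x := integral_congr_ae (ae_of_all _ fun x => by ring)
    _ = _ := key
    _ = _ := integral_congr_ae (ae_of_all _ fun x => by ring)

theorem integrable_one_add_sq_pow (p : ℕ) :
    Integrable (fun x : ℝ => (1 + x ^ 2) ^ p) (gaussMeasure β) := by
  have h : ∀ k : ℕ, Integrable (fun x : ℝ => (x ^ 2) ^ k) (gaussMeasure β) := fun k => by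
    have := (memLp_id_gaussianReal (μ := 0) (v := (1 / β).toNNReal)
      ((2 * k : ℕ))).integrable_norm_pow'
    refine this.congr (ae_of_all _ fun x => ?_)
    simp [pow_mul]
  simp only [add_comm (1 : ℝ), add_pow, one_pow, mul_one]
  exact integrable_finsetSum _ fun k _ => (h k).mul_const _

/-- `f` is measurable and integrable against every polynomial weight under `γ`. -/
structure HasAllMoments (β : ℝ) (f : ℝ → ℝ) : Prop where
  measurable : Measurable f
  integrable : ∀ p : ℕ, Integrable (fun x => (1 + x ^ 2) ^ p * f x) (gaussMeasure β)

theorem HasAllMoments.integrable_self {f : ℝ → ℝ} (hf : HasAllMoments β f) :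
    Integrable f (gaussMeasure β) := by simpa using hf.integrable 0

theorem HasAllMoments.mul {f P : ℝ → ℝ} (hf : HasAllMoments β f) (hP : Measurable P)
    {A : ℝ} {m : ℕ} (hPb : ∀ x, |P x| ≤ A * (1 + x ^ 2) ^ m) :
    HasAllMoments β (fun x => P x * f x) := by
  refine ⟨hP.mul hf.measurable, fun p => ?_⟩
  refine Integrable.mono' ((hf.integrable (p + m)).norm.const_mul A)
    (by have := hf.measurable; fun_prop) (ae_of_all _ fun x => ?_)
  have h1 : (0 : ℝ) ≤ (1 + x ^ 2) ^ p := by positivity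
  have h2 : (0 : ℝ) ≤ (1 + x ^ 2) ^ (p + m) := by positivity
  rw [norm_mul, norm_mul, norm_mul, Real.norm_of_nonneg h1, Real.norm_of_nonneg h2,
    Real.norm_eq_abs, pow_add]
  calc _ ≤ (1 + x ^ 2) ^ p * (A * (1 + x ^ 2) ^ m * ‖f x‖) := by gcongr; exact hPb x
    _ = _ := by ring

theorem abs_le_one_add_sq (x : ℝ) : |x| ≤ 1 + x ^ 2 := by
  nlinarith [sq_nonneg (|x| - 1), sq_abs x, abs_nonneg x]

theorem HasAllMoments.id_mul {f : ℝ → ℝ} (hf : HasAllMoments β f) :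
    HasAllMoments β (fun x => x * f x) :=
  hf.mul measurable_id (A := 1) (m := 1) fun x => by simpa using abs_le_one_add_sq x

theorem hasAllMoments_one : HasAllMoments β (fun _ => 1) :=
  ⟨measurable_const, fun p => by simpa using integrable_one_add_sq_pow p⟩

theorem HasAllMoments.add {f g : ℝ → ℝ} (hf : HasAllMoments β f) (hg : HasAllMoments β g) :
    HasAllMoments β (fun x => f x + g x) :=
  ⟨hf.measurable.add hg.measurable, fun p =>
    ((hf.integrable p).add (hg.integrable p)).congr (ae_of_all _ fun x => by
      simp only [Pi.add_apply]; ring)⟩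

theorem HasAllMoments.const_mul {f : ℝ → ℝ} (hf : HasAllMoments β f) (a : ℝ) :
    HasAllMoments β (fun x => a * f x) :=
  ⟨hf.measurable.const_mul a, fun p => by
    simpa only [mul_left_comm] using (hf.integrable p).const_mul a⟩

/-- A twice continuously differentiable function of polynomial growth, together with its first
two derivatives. -/
structure TwiceTempered (φ : ℝ → ℝ) (A : ℝ) (m : ℕ) : Prop where
  contDiff : ContDiff ℝ 2 φ
  bound : ∀ x, |φ x| ≤ A * (1 + x ^ 2) ^ m
  bound_deriv : ∀ x, |deriv φ x| ≤ A * (1 + x ^ 2) ^ m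
  bound_deriv_deriv : ∀ x, |deriv (deriv φ) x| ≤ A * (1 + x ^ 2) ^ m

theorem ContDiff.hasDerivAt_of_two {φ : ℝ → ℝ} (h : ContDiff ℝ 2 φ) (x : ℝ) :
    HasDerivAt φ (deriv φ x) x :=
  (h.differentiable (by norm_num) x).hasDerivAt

theorem ContDiff.deriv_of_two {φ : ℝ → ℝ} (h : ContDiff ℝ 2 φ) : ContDiff ℝ 1 (deriv φ) :=
  (contDiff_succ_iff_deriv.1 (show ContDiff ℝ (1 + 1) φ from by norm_num; exact h)).2.2

theorem ContDiff.hasDerivAt_deriv_of_two {φ : ℝ → ℝ} (h : ContDiff ℝ 2 φ) (x : ℝ) :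
    HasDerivAt (deriv φ) (deriv (deriv φ) x) x :=
  (h.deriv_of_two.differentiable (by norm_num) x).hasDerivAt

/-- The generator is symmetric in `L²(γ)`. -/
theorem integral_ouGenerator_mul (hβ : 0 < β) {φ f : ℝ → ℝ} {A : ℝ} {m : ℕ}
    (hφ : TwiceTempered φ A m) (hf : ContDiff ℝ 2 f) (h₀ : HasAllMoments β f)
    (h₁ : HasAllMoments β (deriv f)) (h₂ : HasAllMoments β (deriv (deriv f))) :
    ∫ x, ouGenerator β φ x * f x ∂(gaussMeasure β) =
      ∫ x, φ x * ouGenerator β f x ∂(gaussMeasure β) := by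
  have hm0 : Measurable φ := hφ.contDiff.continuous.measurable
  have hm1 : Measurable (deriv φ) := measurable_deriv φ
  have hm2 : Measurable (deriv (deriv φ)) := measurable_deriv _
  have i0 {g : ℝ → ℝ} (hg : HasAllMoments β g) := (hg.mul hm0 hφ.bound).integrable_self
  have i1 {g : ℝ → ℝ} (hg : HasAllMoments β g) := (hg.mul hm1 hφ.bound_deriv).integrable_self
  have i2 {g : ℝ → ℝ} (hg : HasAllMoments β g) :=
    (hg.mul hm2 hφ.bound_deriv_deriv).integrable_self
  have e1 := integral_deriv_mul_gaussMeasure hβ hφ.contDiff.hasDerivAt_deriv_of_two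
    hf.hasDerivAt_of_two (i2 h₀) (i1 h₀.id_mul) (i1 h₁) (i1 h₀)
  have e2 := integral_deriv_mul_gaussMeasure hβ hφ.contDiff.hasDerivAt_of_two
    hf.hasDerivAt_deriv_of_two (i1 h₁) (i0 h₁.id_mul) (i0 h₂) (i0 h₁)
  have a1 : ∫ x, ouGenerator β φ x * f x ∂(gaussMeasure β) =
      1 / 2 * ∫ x, deriv (deriv φ) x * f x ∂(gaussMeasure β) -
        β / 2 * ∫ x, deriv φ x * (x * f x) ∂(gaussMeasure β) := by
    rw [← integral_const_mul, ← integral_const_mul, ← integral_sub ((i2 h₀).const_mul _)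
      ((i1 h₀.id_mul).const_mul _)]
    exact integral_congr_ae (ae_of_all _ fun x => by simp only [ouGenerator]; ring)
  have a2 : ∫ x, deriv φ x * (β * x * f x - deriv f x) ∂(gaussMeasure β) =
      β * ∫ x, deriv φ x * (x * f x) ∂(gaussMeasure β) -
        ∫ x, deriv φ x * deriv f x ∂(gaussMeasure β) := by
    rw [← integral_const_mul, ← integral_sub ((i1 h₀.id_mul).const_mul _) (i1 h₁)]
    exact integral_congr_ae (ae_of_all _ fun x => by ring)
  have a3 : ∫ x, φ x * ouGenerator β f x ∂(gaussMeasure β) =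
      -(1 / 2) * ∫ x, φ x * (β * x * deriv f x - deriv (deriv f) x) ∂(gaussMeasure β) := by
    rw [← integral_const_mul]
    exact integral_congr_ae (ae_of_all _ fun x => by simp only [ouGenerator]; ring)
  rw [a1, a3, e1, a2, ← e2]
  ring

/-! ### Regularity of the semigroup on test functions -/

theorem integrable_comp_of_bounded {Ω : Type*} [MeasurableSpace Ω] {μ : Measure Ω}
    [IsFiniteMeasure μ] {h : ℝ → ℝ} (hm : Measurable h) {A : ℝ} (hb : ∀ x, |h x| ≤ A)
    {g : Ω → ℝ} (hg : Measurable g) : Integrable (fun z => h (g z)) μ :=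
  Integrable.of_bound (hm.comp hg).aestronglyMeasurable A (ae_of_all _ fun z => hb (g z))

/-- The semigroup commutes with `d/dx` up to the contraction factor. -/
theorem hasDerivAt_ouSemigroup_space (hβ : 0 < β) {t : ℝ} (ht : 0 ≤ t) {h h' : ℝ → ℝ} {A : ℝ}
    (hd : ∀ x, HasDerivAt h (h' x) x) (hb : ∀ x, |h x| ≤ A) (hm' : Measurable h')
    (hb' : ∀ x, |h' x| ≤ A) (x : ℝ) :
    HasDerivAt (ouSemigroup β t h) (ouContraction β t * ouSemigroup β t h' x) x := by
  have hm : Measurable h :=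
    (continuous_iff_continuousAt.2 fun x => (hd x).continuousAt).measurable
  rw [funext (ouSemigroup_eq_integral hβ ht hm), ouSemigroup_eq_integral hβ ht hm',
    ← integral_const_mul]
  have hc := ouContraction_pos (β := β) t
  refine (hasDerivAt_integral_of_dominated_loc_of_deriv_le
    (F := fun x z => h (ouContraction β t * x + ouNoise β t * z))
    (F' := fun x z => ouContraction β t * h' (ouContraction β t * x + ouNoise β t * z))
    (bound := fun _ => ouContraction β t * A) Filter.univ_mem
    (.of_forall fun x => ?_) ?_ ?_ (ae_of_all _ fun z x _ => ?_) (integrable_const _)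
    (ae_of_all _ fun z x _ => ?_)).2
  · exact (hm.comp (by fun_prop)).aestronglyMeasurable
  · exact integrable_comp_of_bounded hm hb (by fun_prop)
  · exact ((hm'.comp (by fun_prop)).const_mul _).aestronglyMeasurable
  · rw [norm_mul, Real.norm_of_nonneg hc.le]
    gcongr
    exact hb' _
  · have h1 : HasDerivAt (fun x => ouContraction β t * x + ouNoise β t * z)
        (ouContraction β t) x := by
      simpa using ((hasDerivAt_id x).const_mul (ouContraction β t)).add_const (ouNoise β t * z)
    exact ((hd _).comp x h1).congr_deriv (mul_comm _ _)

theorem continuous_ouSemigroup_space (hβ : 0 < β) {t : ℝ} (ht : 0 ≤ t) {h : ℝ → ℝ} {A : ℝ}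
    (hc : Continuous h) (hb : ∀ x, |h x| ≤ A) : Continuous (ouSemigroup β t h) := by
  rw [funext (ouSemigroup_eq_integral hβ ht hc.measurable)]
  exact continuous_of_dominated
    (fun x => (hc.measurable.comp (by fun_prop)).aestronglyMeasurable)
    (fun x => ae_of_all _ fun z => hb _) (integrable_const A)
    (ae_of_all _ fun z => by fun_prop)

theorem continuous_ouContraction : Continuous (ouContraction β) := by
  unfold ouContraction; fun_prop

theorem continuous_ouNoise : Continuous (ouNoise β) := by
  unfold ouNoise; fun_prop

theorem continuousOn_ouSemigroup_time (hβ : 0 < β) {h : ℝ → ℝ} {A : ℝ}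
    (hc : Continuous h) (hb : ∀ x, |h x| ≤ A) (x : ℝ) :
    ContinuousOn (fun t => ouSemigroup β t h x) (Set.Ici 0) := by
  have : Continuous fun t => ∫ z, h (ouContraction β t * x + ouNoise β t * z) ∂(gaussMeasure β) :=
    continuous_of_dominated
      (fun t => (hc.measurable.comp (by fun_prop)).aestronglyMeasurable)
      (fun t => ae_of_all _ fun z => hb _) (integrable_const A)
      (ae_of_all _ fun z => by
        have := continuous_ouContraction (β := β)
        have := continuous_ouNoise (β := β)
        fun_prop)
  exact this.continuousOn.congr fun t ht => ouSemigroup_eq_integral hβ ht hc.measurable x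

/-- A test function: bounded and `C²` with bounded first and second derivatives. -/
abbrev IsTest (ψ : ℝ → ℝ) (A : ℝ) : Prop := TwiceTempered ψ A 0

namespace TwiceTempered

variable {ψ : ℝ → ℝ} {A : ℝ} {t : ℝ}

theorem deriv_ouSemigroup (hψ : IsTest ψ A) (hβ : 0 < β) (ht : 0 ≤ t) :
    deriv (ouSemigroup β t ψ) = fun x => ouContraction β t * ouSemigroup β t (deriv ψ) x :=
  funext fun x => (hasDerivAt_ouSemigroup_space hβ ht hψ.contDiff.hasDerivAt_of_two
    (fun x => by simpa using hψ.bound x) (measurable_deriv ψ)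
    (fun x => by simpa using hψ.bound_deriv x) x).deriv

theorem hasDerivAt_ouSemigroup_deriv (hψ : IsTest ψ A) (hβ : 0 < β) (ht : 0 ≤ t) (x : ℝ) :
    HasDerivAt (fun x => ouContraction β t * ouSemigroup β t (deriv ψ) x)
      (ouContraction β t ^ 2 * ouSemigroup β t (deriv (deriv ψ)) x) x := by
  have := (hasDerivAt_ouSemigroup_space hβ ht hψ.contDiff.hasDerivAt_deriv_of_two
    (fun x => by simpa using hψ.bound_deriv x) (measurable_deriv _)
    (fun x => by simpa using hψ.bound_deriv_deriv x) x).const_mul (ouContraction β t)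
  exact this.congr_deriv (by ring)

theorem deriv_deriv_ouSemigroup (hψ : IsTest ψ A) (hβ : 0 < β) (ht : 0 ≤ t) :
    deriv (deriv (ouSemigroup β t ψ)) =
      fun x => ouContraction β t ^ 2 * ouSemigroup β t (deriv (deriv ψ)) x := by
  rw [hψ.deriv_ouSemigroup hβ ht]
  exact funext fun x => (hψ.hasDerivAt_ouSemigroup_deriv hβ ht x).deriv

theorem ouGenerator_ouSemigroup (hψ : IsTest ψ A) (hβ : 0 < β) (ht : 0 ≤ t) (x : ℝ) :
    ouGenerator β (ouSemigroup β t ψ) x =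
      1 / 2 * (ouContraction β t ^ 2 * ouSemigroup β t (deriv (deriv ψ)) x) -
        β * x / 2 * (ouContraction β t * ouSemigroup β t (deriv ψ) x) := by
  rw [ouGenerator, hψ.deriv_deriv_ouSemigroup hβ ht, hψ.deriv_ouSemigroup hβ ht]

/-- The semigroup preserves test functions, without deterioration of the bounds. -/
theorem ouSemigroup (hψ : IsTest ψ A) (hβ : 0 < β) (ht : 0 ≤ t) :
    IsTest (ouSemigroup β t ψ) A := by
  have hA : 0 ≤ A := by simpa using (abs_nonneg _).trans (hψ.bound 0)
  have hc0 := ouContraction_pos (β := β) t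
  have hc1 := ouContraction_le_one hβ ht
  have e1 := hψ.deriv_ouSemigroup hβ ht
  have e2 := hψ.deriv_deriv_ouSemigroup hβ ht
  refine ⟨?_, fun x => ?_, fun x => ?_, fun x => ?_⟩
  · have h1 : ContDiff ℝ 1 (deriv (_root_.ouSemigroup β t ψ)) := by
      refine contDiff_one_iff_deriv.2 ⟨?_, ?_⟩
      · rw [e1]
        exact fun x => (hψ.hasDerivAt_ouSemigroup_deriv hβ ht x).differentiableAt
      · rw [e2]
        exact (continuous_ouSemigroup_space hβ ht
          (hψ.contDiff.deriv_of_two.continuous_deriv le_rfl)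
          (fun x => by simpa using hψ.bound_deriv_deriv x)).const_mul _
    have h2 : ContDiff ℝ (1 + 1) (_root_.ouSemigroup β t ψ) := by
      refine contDiff_succ_iff_deriv.2 ⟨fun x => ?_, by simp, h1⟩
      exact (hasDerivAt_ouSemigroup_space hβ ht hψ.contDiff.hasDerivAt_of_two
        (fun x => by simpa using hψ.bound x) (measurable_deriv ψ)
        (fun x => by simpa using hψ.bound_deriv x) x).differentiableAt
    norm_num at h2
    exact h2
  · simpa using abs_ouSemigroup_le (fun x => by simpa using hψ.bound x) x
  · rw [e1, abs_mul, abs_of_pos hc0]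
    simpa using mul_le_mul hc1
      (abs_ouSemigroup_le (β := β) (t := t) (fun x => by simpa using hψ.bound_deriv x) x)
      (abs_nonneg _) zero_le_one
  · rw [e2, abs_mul, abs_of_pos (pow_pos hc0 2)]
    simpa using mul_le_mul (pow_le_one₀ hc0.le hc1 (n := 2))
      (abs_ouSemigroup_le (β := β) (t := t)
        (fun x => by simpa using hψ.bound_deriv_deriv x) x)
      (abs_nonneg _) zero_le_one

end TwiceTempered

theorem hasDerivAt_ouContraction (t : ℝ) :
    HasDerivAt (ouContraction β) (-(β / 2) * ouContraction β t) t := by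
  refine ((((hasDerivAt_id t).const_mul (-β)).div_const 2).exp).congr_deriv ?_
  simp [ouContraction]
  ring

theorem hasDerivAt_ouNoise (hβ : 0 < β) {t : ℝ} (ht : 0 < t) :
    HasDerivAt (ouNoise β) (β * ouContraction β t ^ 2 / (2 * ouNoise β t)) t := by
  have h1 : (1 - Real.exp (-β * t)) ≠ 0 :=
    (sub_pos.2 (Real.exp_lt_one_iff.2 (by nlinarith))).ne'
  refine ((((hasDerivAt_id t).const_mul (-β)).exp).const_sub 1 |>.sqrt h1).congr_deriv ?_
  rw [ouContraction_sq, ouNoise]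
  simp
  ring

theorem ouNoise_mono (hβ : 0 < β) {s t : ℝ} (h : s ≤ t) : ouNoise β s ≤ ouNoise β t := by
  unfold ouNoise
  gcongr 1 - Real.exp ?_ |>.sqrt
  nlinarith

/-- Gaussian integration by parts in the noise variable of Mehler's formula. -/
theorem integral_noise_mul (hβ : 0 < β) {h h' : ℝ → ℝ} {A : ℝ} (a b : ℝ)
    (hd : ∀ x, HasDerivAt h (h' x) x) (hb : ∀ x, |h x| ≤ A) (hm' : Measurable h')
    (hb' : ∀ x, |h' x| ≤ A) :
    β * ∫ z, h (a + b * z) * z ∂(gaussMeasure β) =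
      b * ∫ z, h' (a + b * z) ∂(gaussMeasure β) := by
  have hm : Measurable h :=
    (continuous_iff_continuousAt.2 fun x => (hd x).continuousAt).measurable
  have hz : Integrable (fun z : ℝ => z) (gaussMeasure β) := by
    simpa using (hasAllMoments_one (β := β)).id_mul.integrable_self
  have hhz : Integrable (fun z => h (a + b * z) * z) (gaussMeasure β) :=
    hz.bdd_mul (c := A) (hm.comp (by fun_prop)).aestronglyMeasurable (ae_of_all _ fun z => hb _)
  have key := integral_deriv_mul_gaussMeasure hβ (φ := fun z => h (a + b * z))
    (φ' := fun z => b * h' (a + b * z)) (f := fun _ => 1) (f' := fun _ => 0)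
    (fun z => by
      have h1 : HasDerivAt (fun z => a + b * z) b z := by
        simpa using ((hasDerivAt_id z).const_mul b).const_add a
      exact ((hd _).comp z h1).congr_deriv (mul_comm _ _))
    (fun z => hasDerivAt_const z 1)
    (by simpa using (integrable_comp_of_bounded hm' hb' (by fun_prop)).const_mul b)
    (by simpa using hhz) (by simp)
    (by simpa using integrable_comp_of_bounded hm hb (by fun_prop))
  simp only [mul_one, sub_zero] at key
  rw [← integral_const_mul, ← integral_const_mul, key]
  exact integral_congr_ae (ae_of_all _ fun z => by ring)

/-- The backward equation `∂_t e^{tB} ψ = B e^{tB} ψ` for test functions. -/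
theorem TwiceTempered.hasDerivAt_ouSemigroup_time {ψ : ℝ → ℝ} {A : ℝ} (hψ : IsTest ψ A)
    (hβ : 0 < β) {t : ℝ} (ht : 0 < t) (x : ℝ) :
    HasDerivAt (fun s => _root_.ouSemigroup β s ψ x)
      (ouGenerator β (_root_.ouSemigroup β t ψ) x) t := by
  have hm : Measurable ψ := hψ.contDiff.continuous.measurable
  have hm1 : Measurable (deriv ψ) := measurable_deriv ψ
  have hm2 : Measurable (deriv (deriv ψ)) := measurable_deriv _
  have hb0 : ∀ x, |ψ x| ≤ A := fun x => by simpa using hψ.bound x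
  have hb1 : ∀ x, |deriv ψ x| ≤ A := fun x => by simpa using hψ.bound_deriv x
  have hb2 : ∀ x, |deriv (deriv ψ) x| ≤ A := fun x => by simpa using hψ.bound_deriv_deriv x
  have hA : 0 ≤ A := (abs_nonneg _).trans (hb0 0)
  have hz : Integrable (fun z : ℝ => z) (gaussMeasure β) := by
    simpa using (hasAllMoments_one (β := β)).id_mul.integrable_self
  have hn := ouNoise_pos hβ (half_pos ht)
  have hnt := ouNoise_pos hβ ht
  have hD := (hasDerivAt_integral_of_dominated_loc_of_deriv_le (μ := gaussMeasure β)
    (F := fun s z => ψ (ouContraction β s * x + ouNoise β s * z))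
    (F' := fun s z => deriv ψ (ouContraction β s * x + ouNoise β s * z) *
      (-(β / 2) * ouContraction β s * x + β * ouContraction β s ^ 2 / (2 * ouNoise β s) * z))
    (bound := fun z => A * (β / 2 * |x| + β / (2 * ouNoise β (t / 2)) * |z|))
    (lt_mem_nhds (show t / 2 < t by linarith))
    (.of_forall fun s => (hm.comp (by fun_prop)).aestronglyMeasurable)
    (integrable_comp_of_bounded hm hb0 (by fun_prop))
    ((hm1.comp (by fun_prop)).mul (by fun_prop)).aestronglyMeasurable
    (ae_of_all _ fun z s hs => ?_)
    (((integrable_const _).add (hz.abs.const_mul _)).const_mul A)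
    (ae_of_all _ fun z s hs => ?_)).2
  · refine (hD.congr_of_eventuallyEq ?_).congr_deriv ?_
    · filter_upwards [lt_mem_nhds ht] with s hs
      exact ouSemigroup_eq_integral hβ hs.le hm x
    · rw [hψ.ouGenerator_ouSemigroup hβ ht.le, ouSemigroup_eq_integral hβ ht.le hm1,
        ouSemigroup_eq_integral hβ ht.le hm2]
      have hS := integral_noise_mul hβ (ouContraction β t * x) (ouNoise β t)
        hψ.contDiff.hasDerivAt_deriv_of_two hb1 hm2 hb2
      have i1 : Integrable (fun z => deriv ψ (ouContraction β t * x + ouNoise β t * z))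
          (gaussMeasure β) := integrable_comp_of_bounded hm1 hb1 (by fun_prop)
      have i2 : Integrable (fun z => deriv ψ (ouContraction β t * x + ouNoise β t * z) * z)
          (gaussMeasure β) :=
        hz.bdd_mul (c := A) (hm1.comp (by fun_prop)).aestronglyMeasurable
          (ae_of_all _ fun z => hb1 _)
      have hsplit : ∫ z, deriv ψ (ouContraction β t * x + ouNoise β t * z) *
            (-(β / 2) * ouContraction β t * x +
              β * ouContraction β t ^ 2 / (2 * ouNoise β t) * z) ∂(gaussMeasure β) =
          (-(β / 2) * ouContraction β t * x) *
              ∫ z, deriv ψ (ouContraction β t * x + ouNoise β t * z) ∂(gaussMeasure β) +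
            (ouContraction β t ^ 2 / (2 * ouNoise β t)) *
              (β * ∫ z, deriv ψ (ouContraction β t * x + ouNoise β t * z) * z
                ∂(gaussMeasure β)) := by
        rw [← integral_const_mul, ← integral_const_mul, ← integral_const_mul,
          ← integral_add (i1.const_mul _) ((i2.const_mul _).const_mul _)]
        exact integral_congr_ae (ae_of_all _ fun z => by ring)
      rw [hsplit, hS]
      field_simp
      ring
  · have hs0 : 0 < s := (half_pos ht).trans hs
    have hc0 := ouContraction_pos (β := β) s
    have hc1 := ouContraction_le_one hβ hs0.le
    have hns := ouNoise_mono hβ (le_of_lt hs)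
    rw [norm_mul]
    refine mul_le_mul (hb1 _) ?_ (norm_nonneg _) hA
    refine (norm_add_le _ _).trans (add_le_add ?_ ?_)
    · rw [norm_mul, norm_mul, norm_neg, Real.norm_of_nonneg (by positivity),
        Real.norm_of_nonneg hc0.le, Real.norm_eq_abs]
      calc β / 2 * ouContraction β s * |x| ≤ β / 2 * 1 * |x| := by gcongr
        _ = _ := by ring
    · have hns0 := hn.trans_le hns
      rw [norm_mul, Real.norm_of_nonneg (by positivity), Real.norm_eq_abs]
      gcongr
      calc β * ouContraction β s ^ 2 ≤ β * 1 := by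
            gcongr; exact pow_le_one₀ hc0.le hc1
        _ = β := mul_one β
  · have hs0 : 0 < s := (half_pos ht).trans hs
    exact (hψ.contDiff.hasDerivAt_of_two _).comp s
      (((hasDerivAt_ouContraction s).mul_const x).add ((hasDerivAt_ouNoise hβ hs0).mul_const z))

/-! ### Duality and the truncated exponential series -/

/-- The `L¹` norm is the supremum of the pairings with test functions bounded by `1`. -/
theorem integral_abs_le_of_forall_test {μ : Measure ℝ} [IsProbabilityMeasure μ] {h : ℝ → ℝ}
    (hh : Integrable h μ) {R : ℝ}
    (H : ∀ ψ A, IsTest ψ A → (∀ x, |ψ x| ≤ 1) → ∫ x, ψ x * h x ∂μ ≤ R) :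
    ∫ x, |h x| ∂μ ≤ R := by
  refine le_of_forall_pos_le_add fun ε' hε' => ?_
  obtain ⟨ε, hε, rfl⟩ : ∃ ε, 0 < ε ∧ ε' = 3 * ε := ⟨ε' / 3, by positivity, by ring⟩
  obtain ⟨k, hkc, hk, hkε⟩ := (memLp_one_iff_integrable.2 hh).exist_eLpNorm_sub_le
    ENNReal.one_ne_top le_rfl hε
  have hki : Integrable k μ := hk.continuous.integrable_of_hasCompactSupport hkc
  have hε1 : ∫ x, |h x - k x| ∂μ ≤ ε := by
    have h1 := ENNReal.toReal_mono ENNReal.ofReal_ne_top hkε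
    rw [ENNReal.toReal_ofReal hε.le, eLpNorm_one_eq_lintegral_enorm,
      ← integral_norm_eq_lintegral_enorm (hh.sub hki).aestronglyMeasurable] at h1
    simpa using h1
  -- `ψ` is a smooth approximation of the sign of `k`
  set ψ : ℝ → ℝ := fun x => (√(k x ^ 2 + ε ^ 2))⁻¹ * k x with hψdef
  have hpos : ∀ x, 0 < k x ^ 2 + ε ^ 2 := fun x => by positivity
  have hψd : ContDiff ℝ 2 ψ := by
    have hk2 : ContDiff ℝ 2 k := mod_cast contDiff_infty.1 hk 2
    refine ContDiff.mul (ContDiff.inv ?_ fun x => (Real.sqrt_pos.2 (hpos x)).ne') hk2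
    exact ((hk2.pow 2).add contDiff_const).sqrt fun x => (hpos x).ne'
  have hψc : HasCompactSupport ψ := hkc.mul_left
  have hle : ∀ x, |k x| ≤ √(k x ^ 2 + ε ^ 2) := fun x =>
    Real.abs_le_sqrt (by nlinarith)
  have hψ1 : ∀ x, |ψ x| ≤ 1 := fun x => by
    have h0 := Real.sqrt_pos.2 (hpos x)
    rw [hψdef, abs_mul, abs_of_pos (inv_pos.2 h0), inv_mul_le_one₀ h0]
    exact hle x
  have hψk : ∀ x, |k x| - ε ≤ ψ x * k x := fun x => by
    have h0 := Real.sqrt_pos.2 (hpos x)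
    have h1 : √(k x ^ 2 + ε ^ 2) ≤ |k x| + ε :=
      Real.sqrt_le_iff.2 ⟨by positivity, by nlinarith [sq_abs (k x), abs_nonneg (k x)]⟩
    have h2 : ψ x * k x = k x ^ 2 / √(k x ^ 2 + ε ^ 2) := by rw [hψdef]; field_simp
    rw [h2, le_div_iff₀ h0]
    rcases le_total (|k x|) ε with h3 | h3
    · nlinarith [sq_nonneg (k x)]
    · nlinarith [sq_abs (k x), mul_le_mul_of_nonneg_left h1 (sub_nonneg.2 h3), sq_nonneg ε]
  obtain ⟨A0, hA0⟩ := hψd.continuous.bounded_above_of_compact_support hψc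
  obtain ⟨A1, hA1⟩ := (hψd.continuous_deriv (by norm_num)).bounded_above_of_compact_support
    hψc.deriv
  obtain ⟨A2, hA2⟩ := (hψd.deriv_of_two.continuous_deriv le_rfl).bounded_above_of_compact_support
    hψc.deriv.deriv
  have hT : IsTest ψ (max A0 (max A1 A2)) :=
    ⟨hψd, fun x => by simpa using Or.inl (hA0 x), fun x => by simpa using Or.inr (.inl (hA1 x)),
      fun x => by simpa using Or.inr (.inr (hA2 x))⟩
  have hψm : AEStronglyMeasurable ψ μ := hψd.continuous.aestronglyMeasurable
  have i1 : Integrable (fun x => ψ x * h x) μ := hh.bdd_mul hψm (ae_of_all _ hψ1)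
  have i2 : Integrable (fun x => |h x - k x|) μ := (hh.sub hki).abs
  have h3 : ∫ x, |h x| ∂μ ≤ ∫ x, (ψ x * h x + 2 * |h x - k x| + ε) ∂μ := by
    refine integral_mono hh.abs ((i1.add (i2.const_mul 2)).add (integrable_const ε)) fun x => ?_
    have e1 : ψ x * k x ≤ ψ x * h x + |h x - k x| := by
      have : -(ψ x * (h x - k x)) ≤ 1 * |h x - k x| :=
        (neg_le_abs _).trans (by rw [abs_mul]; gcongr; exact hψ1 x)
      linarith
    have e2 : |h x| ≤ |k x| + |h x - k x| := by
      have := abs_add_le (k x) (h x - k x)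
      simpa using this
    have := hψk x
    show |h x| ≤ ψ x * h x + 2 * |h x - k x| + ε
    linarith
  have h4 : ∫ x, (ψ x * h x + 2 * |h x - k x| + ε) ∂μ =
      ∫ x, ψ x * h x ∂μ + 2 * ∫ x, |h x - k x| ∂μ + ε := by
    have i3 : Integrable (fun x => ψ x * h x + 2 * |h x - k x|) μ := i1.add (i2.const_mul 2)
    rw [integral_add i3 (integrable_const ε), integral_add i1 (i2.const_mul 2), integral_const_mul]
    simp
  have h5 := H ψ _ hT hψ1
  linarith

/-- A `C²` function which, with its first two derivatives, is integrable against all polynomials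
under `γ`. The generator can be moved onto such functions by parts. -/
structure SmoothAllMoments (β : ℝ) (f : ℝ → ℝ) : Prop where
  contDiff : ContDiff ℝ 2 f
  moments : HasAllMoments β f
  moments_deriv : HasAllMoments β (deriv f)
  moments_deriv_deriv : HasAllMoments β (deriv (deriv f))

theorem SmoothAllMoments.ouGenerator {f : ℝ → ℝ} (hf : SmoothAllMoments β f) :
    HasAllMoments β (ouGenerator β f) := by
  have := (hf.moments_deriv_deriv.const_mul (1 / 2)).add (hf.moments_deriv.id_mul.const_mul (-(β / 2)))
  refine ⟨?_, fun p => (this.integrable p).congr (ae_of_all _ fun x => ?_)⟩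
  · have := hf.moments_deriv.measurable
    have := hf.moments_deriv_deriv.measurable
    unfold _root_.ouGenerator
    fun_prop
  · simp only [_root_.ouGenerator]; ring

section pairing

variable {ψ f : ℝ → ℝ} {A : ℝ}

theorem abs_ouGenerator_ouSemigroup_le (hψ : IsTest ψ A) (hβ : 0 < β) {t : ℝ} (ht : 0 ≤ t)
    (x : ℝ) : |ouGenerator β (ouSemigroup β t ψ) x| ≤ A * (1 + β) * (1 + x ^ 2) := by
  have h := hψ.ouSemigroup hβ ht
  have hA : 0 ≤ A := by simpa using (abs_nonneg _).trans (hψ.bound 0)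
  have h1 := h.bound_deriv x
  have h2 := h.bound_deriv_deriv x
  simp only [pow_zero, mul_one] at h1 h2
  rw [ouGenerator]
  refine (abs_sub _ _).trans ?_
  rw [abs_mul, abs_mul, abs_div (β * x), abs_mul β, abs_of_pos hβ]
  norm_num
  have h3 : β * |x| / 2 * |deriv (ouSemigroup β t ψ) x| ≤ β * (1 + x ^ 2) / 2 * A := by
    gcongr
    exact abs_le_one_add_sq x
  have h4 : 0 ≤ A * x ^ 2 := by positivity
  nlinarith [mul_nonneg hβ.le h4, mul_nonneg hβ.le hA]

theorem hasDerivAt_integral_ouSemigroup_mul (hψ : IsTest ψ A) (hβ : 0 < β)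
    (hf : SmoothAllMoments β f) {t : ℝ} (ht : 0 < t) :
    HasDerivAt (fun s => ∫ x, ouSemigroup β s ψ x * f x ∂(gaussMeasure β))
      (∫ x, ouSemigroup β t ψ x * ouGenerator β f x ∂(gaussMeasure β)) t := by
  rw [← integral_ouGenerator_mul hβ (hψ.ouSemigroup hβ ht.le) hf.contDiff hf.moments
    hf.moments_deriv hf.moments_deriv_deriv]
  have hm : Measurable f := hf.moments.measurable
  have hms : ∀ s, 0 ≤ s → Measurable (ouSemigroup β s ψ) := fun s hs =>
    (hψ.ouSemigroup hβ hs).contDiff.continuous.measurable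
  refine (hasDerivAt_integral_of_dominated_loc_of_deriv_le (μ := gaussMeasure β)
    (F := fun s x => ouSemigroup β s ψ x * f x)
    (F' := fun s x => ouGenerator β (ouSemigroup β s ψ) x * f x)
    (bound := fun x => A * (1 + β) * ‖(1 + x ^ 2) ^ 1 * f x‖)
    (lt_mem_nhds ht) ?_ ?_ ?_ (ae_of_all _ fun x s hs => ?_)
    ((hf.moments.integrable 1).norm.const_mul _) (ae_of_all _ fun x s hs => ?_)).2
  · filter_upwards [lt_mem_nhds ht] with s hs
    exact ((hms s (le_of_lt hs)).mul hm).aestronglyMeasurable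
  · exact (hf.moments.mul (hms t ht.le) (hψ.ouSemigroup hβ ht.le).bound).integrable_self
  · have h1 : Measurable (ouGenerator β (ouSemigroup β t ψ)) := by
      have := measurable_deriv (ouSemigroup β t ψ)
      have := measurable_deriv (deriv (ouSemigroup β t ψ))
      unfold ouGenerator
      fun_prop
    exact (h1.mul hm).aestronglyMeasurable
  · have h1 : (0 : ℝ) ≤ 1 + x ^ 2 := by positivity
    rw [norm_mul, norm_mul, pow_one, Real.norm_of_nonneg h1, ← mul_assoc]
    gcongr
    exact abs_ouGenerator_ouSemigroup_le hψ hβ (le_of_lt hs) x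
  · exact (hψ.hasDerivAt_ouSemigroup_time hβ hs x).mul_const _

theorem continuousOn_integral_ouSemigroup_mul (hψ : IsTest ψ A) (hβ : 0 < β)
    (hf : HasAllMoments β f) :
    ContinuousOn (fun s => ∫ x, ouSemigroup β s ψ x * f x ∂(gaussMeasure β)) (Set.Ici 0) := by
  refine continuousOn_of_dominated (bound := fun x => A * ‖f x‖) (fun s hs => ?_)
    (fun s hs => ae_of_all _ fun x => ?_) (hf.integrable_self.norm.const_mul A)
    (ae_of_all _ fun x => ?_)
  · exact ((hψ.ouSemigroup hβ hs).contDiff.continuous.measurable.mul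
      hf.measurable).aestronglyMeasurable
  · rw [norm_mul]
    gcongr
    simpa using (hψ.ouSemigroup hβ hs).bound x
  · exact (continuousOn_ouSemigroup_time hβ hψ.contDiff.continuous
      (fun x => by simpa using hψ.bound x) x).mul continuousOn_const

theorem ouSemigroup_zero_time (ψ : ℝ → ℝ) (x : ℝ) : ouSemigroup β 0 ψ x = ψ x := by
  simp [ouSemigroup, ouKernel]

/-- If `Jₖ' = Jₖ₊₁`, the Taylor polynomial based at the moving point `s` and evaluated at `0`
depends on `s` only through its last term. -/
theorem hasDerivAt_taylor_moving_base (J : ℕ → ℝ → ℝ) (s : ℝ) (L : ℕ)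
    (hJ : ∀ k ≤ L, HasDerivAt (J k) (J (k + 1) s) s) :
    HasDerivAt (fun r => ∑ k ∈ Finset.range (L + 1), (-r) ^ k / k.factorial * J k r)
      ((-s) ^ L / L.factorial * J (L + 1) s) s := by
  induction L with
  | zero => simpa using hJ 0 le_rfl
  | succ L ih =>
    have h1 := ih fun k hk => hJ k (hk.trans (Nat.le_succ _))
    have h2 : HasDerivAt (fun r : ℝ => (-r) ^ (L + 1) / (L + 1).factorial)
        (-((-s) ^ L / L.factorial)) s := by
      refine (((hasDerivAt_id s).neg.pow (L + 1)).div_const _).congr_deriv ?_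
      rw [Nat.factorial_succ]
      push_cast
      simp
      field_simp
    have h3 := h1.add (h2.mul (hJ (L + 1) le_rfl))
    refine (h3.congr_of_eventuallyEq (.of_forall fun r => ?_)).congr_deriv ?_
    · rw [Finset.sum_range_succ]; rfl
    · ring

/-- The truncated exponential series of `-tB` inverts `e^{tB}` up to an error of order `t ^ K`,
tested against a function bounded by `1`. -/
theorem abs_integral_inverse_expansion_sub_le (hβ : 0 < β) {K : ℕ} (hK : 1 ≤ K) {f : ℕ → ℝ → ℝ}
    (hf : ∀ k < K, SmoothAllMoments β (f k)) (hB : ∀ k < K, f (k + 1) = ouGenerator β (f k))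
    (hψ : IsTest ψ A) (hψ1 : ∀ x, |ψ x| ≤ 1) {t : ℝ} (ht : 0 ≤ t) :
    |∫ x, ouSemigroup β t ψ x * ∑ k ∈ Finset.range K, (-t) ^ k / k.factorial * f k x
        ∂(gaussMeasure β) - ∫ x, ψ x * f 0 x ∂(gaussMeasure β)| ≤
      t ^ K * ∫ x, |f K x| ∂(gaussMeasure β) := by
  obtain ⟨L, rfl⟩ : ∃ L, K = L + 1 := ⟨K - 1, by omega⟩
  have hmom : ∀ k ≤ L + 1, HasAllMoments β (f k) := by
    intro k hk
    rcases k with _ | k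
    · exact (hf 0 (by omega)).moments
    · rw [hB k (by omega)]; exact (hf k (by omega)).ouGenerator
  set J : ℕ → ℝ → ℝ := fun k s => ∫ x, ouSemigroup β s ψ x * f k x ∂(gaussMeasure β) with hJ
  set G : ℝ → ℝ := fun s => ∑ k ∈ Finset.range (L + 1), (-s) ^ k / k.factorial * J k s with hG
  have hGt : ∫ x, ouSemigroup β t ψ x * ∑ k ∈ Finset.range (L + 1), (-t) ^ k / k.factorial * f k x
      ∂(gaussMeasure β) = G t := by
    have hi : ∀ k ∈ Finset.range (L + 1), Integrable (fun x => (-t) ^ k / k.factorial *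
        (ouSemigroup β t ψ x * f k x)) (gaussMeasure β) := fun k hk =>
      ((hmom k (by have := Finset.mem_range.1 hk; omega)).mul
        (hψ.ouSemigroup hβ ht).contDiff.continuous.measurable
        (hψ.ouSemigroup hβ ht).bound).integrable_self.const_mul _
    simp only [hG, hJ, ← integral_const_mul]
    rw [← integral_finsetSum _ hi]
    refine integral_congr_ae (ae_of_all _ fun x => ?_)
    simp only [Finset.mul_sum]
    exact Finset.sum_congr rfl fun k _ => by ring
  have hG0 : G 0 = ∫ x, ψ x * f 0 x ∂(gaussMeasure β) := by
    simp only [hG, Finset.sum_range_succ', neg_zero, ne_eq, Nat.add_eq_zero_iff, one_ne_zero,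
      and_false, not_false_eq_true, zero_pow, zero_div, zero_mul, Finset.sum_const_zero]
    simp [hJ, ouSemigroup_zero_time]
  rw [hGt, ← hG0]
  rcases ht.eq_or_lt with rfl | htpos
  · simp
  have hcont : ContinuousOn G (Set.Icc 0 t) := by
    refine continuousOn_finsetSum _ fun k hk => ContinuousOn.mul (by fun_prop) ?_
    exact (continuousOn_integral_ouSemigroup_mul hψ hβ
      (hmom k (by have := Finset.mem_range.1 hk; omega))).mono Set.Icc_subset_Ici_self
  have hder : ∀ s ∈ Set.Ioo 0 t, HasDerivAt G ((-s) ^ L / L.factorial * J (L + 1) s) s :=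
    fun s hs => hasDerivAt_taylor_moving_base J s L fun k hk => by
      have := hasDerivAt_integral_ouSemigroup_mul hψ hβ (hf k (by omega)) hs.1
      rwa [← hB k (by omega)] at this
  obtain ⟨s, hs, hslope⟩ := exists_hasDerivAt_eq_slope G _ htpos hcont hder
  rw [sub_zero, eq_div_iff htpos.ne'] at hslope
  rw [← hslope, abs_mul, abs_mul, abs_of_pos htpos, abs_div, abs_pow, abs_neg, abs_of_pos hs.1,
    Nat.abs_cast]
  have hJb : |J (L + 1) s| ≤ ∫ x, |f (L + 1) x| ∂(gaussMeasure β) := by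
    refine norm_integral_le_of_norm_le (μ := gaussMeasure β)
      (f := fun x => ouSemigroup β s ψ x * f (L + 1) x)
      (hmom (L + 1) le_rfl).integrable_self.abs (ae_of_all _ fun x => ?_)
    rw [norm_mul, Real.norm_eq_abs, Real.norm_eq_abs]
    exact mul_le_of_le_one_left (abs_nonneg _) (abs_ouSemigroup_le hψ1 x)
  have hfac : s ^ L / L.factorial ≤ t ^ L := by
    have h1 : s ^ L ≤ t ^ L := pow_le_pow_left₀ hs.1.le hs.2.le L
    have h2 : (1 : ℝ) ≤ L.factorial := by exact_mod_cast L.factorial_pos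
    exact (div_le_self (pow_nonneg hs.1.le L) h2).trans h1
  calc s ^ L / L.factorial * |J (L + 1) s| * t
      ≤ t ^ L * (∫ x, |f (L + 1) x| ∂(gaussMeasure β)) * t := by gcongr
    _ = _ := by ring

end pairing

/-! ### Change of measure in the logarithmic Sobolev inequality, and products -/

/-- Holley-Stroock: the logarithmic Sobolev inequality is stable under a change of measure with
density bounded above and below, and the constant is multiplied by at most the product of the
two bounds. -/
theorem LogSobolev.of_le_smul {ν ν' : Measure ℝ} [IsProbabilityMeasure ν] [IsProbabilityMeasure ν']
    {r r' : NNReal} (h₁ : ν' ≤ r • ν) (h₂ : ν ≤ r' • ν') {c C : ℝ} (hc : 0 < c)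
    (hC : r * r' * c ≤ C) (H : LogSobolev ν c) : LogSobolev ν' C := by
  intro h h0 hi hone hac hdi
  have toν {f : ℝ → ℝ} (hf : Integrable f ν') : Integrable f ν :=
    (hf.smul_measure_nnreal (c := r')).mono_measure h₂
  have toν' {f : ℝ → ℝ} (hf : Integrable f ν) : Integrable f ν' :=
    (hf.smul_measure_nnreal (c := r)).mono_measure h₁
  have le' {f : ℝ → ℝ} (hf : Integrable f ν) (hf0 : ∀ x, 0 ≤ f x) :
      ∫ x, f x ∂ν' ≤ r * ∫ x, f x ∂ν := by
    have := integral_mono_measure h₁ (ae_of_all _ hf0) (hf.smul_measure_nnreal (c := r))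
    rwa [integral_smul_nnreal_measure] at this
  have le {f : ℝ → ℝ} (hf : Integrable f ν') (hf0 : ∀ x, 0 ≤ f x) :
      ∫ x, f x ∂ν ≤ r' * ∫ x, f x ∂ν' := by
    have := integral_mono_measure h₂ (ae_of_all _ hf0) (hf.smul_measure_nnreal (c := r'))
    rwa [integral_smul_nnreal_measure] at this
  set Z := ∫ x, h x ∂ν with hZ
  have hZ0 : 0 < Z := by
    have := le' (toν hi) h0
    rw [hone] at this
    exact pos_of_mul_pos_right (by linarith) r.coe_nonneg
  have hsq : ∀ x, √(h x / Z) = (√Z)⁻¹ * √(h x) := fun x => by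
    rw [Real.sqrt_div' _ hZ0.le]; ring
  have hder : ∀ x, deriv (fun z => √(h z / Z)) x ^ 2 = Z⁻¹ * deriv (fun z => √(h z)) x ^ 2 :=
    fun x => by
      simp only [hsq]
      rw [deriv_const_mul_field, mul_pow, inv_pow, Real.sq_sqrt hZ0.le]
  obtain ⟨hL1, hL2⟩ := H (fun x => h x / Z) (fun x => div_nonneg (h0 x) hZ0.le)
    ((toν hi).div_const Z) (by rw [integral_div, ← hZ, div_self hZ0.ne'])
    (fun a b => by simpa only [hsq] using (hac a b).const_mul _)
    (by simpa only [hder] using (toν hdi).const_mul _)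
  have hlog : ∀ x, h x / Z * Real.log (h x / Z) =
      Z⁻¹ * (h x * Real.log (h x) - Real.log Z * h x) := fun x => by
    rcases (h0 x).eq_or_lt with hx | hx
    · simp [← hx]
    · rw [Real.log_div hx.ne' hZ0.ne']; ring
  have hli : Integrable (fun x => h x * Real.log (h x)) ν := by
    refine ((hL1.const_mul Z).add ((toν hi).const_mul (Real.log Z))).congr
      (ae_of_all _ fun x => ?_)
    simp only [Pi.add_apply, hlog]
    field_simp
    ring
  refine ⟨toν' hli, ?_⟩
  -- the integrand `Z Φ(h / Z)`, with `Φ(s) = s log s - s + 1 ≥ 0`, is compared pointwise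
  set E : ℝ → ℝ := fun x => h x * Real.log (h x) - Real.log Z * h x - h x + Z with hE
  have hE0 : ∀ x, 0 ≤ E x := fun x => by
    rcases (h0 x).eq_or_lt with hx | hx
    · simp [hE, ← hx, hZ0.le]
    · have h3 := Real.log_le_sub_one_of_pos (div_pos hZ0 hx)
      rw [Real.log_div hZ0.ne' hx.ne'] at h3
      have h4 := mul_le_mul_of_nonneg_left h3 hx.le
      have h5 : h x * (Z / h x - 1) = Z - h x := by field_simp
      simp only [hE]
      nlinarith
  have hEi : Integrable E ν :=
    ((hli.sub ((toν hi).const_mul _)).sub (toν hi)).add (integrable_const Z)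
  have intE {μ : Measure ℝ} [IsProbabilityMeasure μ] (hhi : Integrable h μ)
      (hhl : Integrable (fun x => h x * Real.log (h x)) μ) : ∫ x, E x ∂μ =
      ∫ x, h x * Real.log (h x) ∂μ - Real.log Z * ∫ x, h x ∂μ - ∫ x, h x ∂μ + Z := by
    have j1 : Integrable (fun x => h x * Real.log (h x) - Real.log Z * h x) μ :=
      hhl.sub (hhi.const_mul _)
    have j2 : Integrable (fun x => h x * Real.log (h x) - Real.log Z * h x - h x) μ :=
      j1.sub hhi
    simp only [hE]
    rw [integral_add j2 (integrable_const Z), integral_sub j1 hhi,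
      integral_sub hhl (hhi.const_mul _), integral_const_mul]
    simp
  have e1 := intE (toν hi) hli
  have e2 := intE hi (toν' hli)
  rw [hone] at e2
  rw [← hZ] at e1
  have e3 := le' hEi hE0
  have e4 := le hdi fun x => sq_nonneg _
  have e5 : ∫ x, h x * Real.log (h x) ∂ν - Real.log Z * Z ≤
      c * ∫ x, deriv (fun z => √(h z)) x ^ 2 ∂ν := by
    simp only [hlog, hder] at hL2
    rw [integral_const_mul, integral_const_mul, integral_sub hli ((toν hi).const_mul _),
      integral_const_mul, ← hZ] at hL2
    have := mul_le_mul_of_nonneg_left hL2 hZ0.le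
    field_simp at this
    linarith
  have e6 := Real.log_le_sub_one_of_pos hZ0
  have hI : 0 ≤ ∫ x, deriv (fun z => √(h z)) x ^ 2 ∂ν' := integral_nonneg fun x => sq_nonneg _
  calc ∫ x, h x * Real.log (h x) ∂ν' ≤ ∫ x, E x ∂ν' := by linarith
    _ ≤ r * ∫ x, E x ∂ν := e3
    _ ≤ r * (c * ∫ x, deriv (fun z => √(h z)) x ^ 2 ∂ν) := by
        gcongr; linarith
    _ ≤ r * (c * (r' * ∫ x, deriv (fun z => √(h z)) x ^ 2 ∂ν')) := by gcongr
    _ = r * r' * c * ∫ x, deriv (fun z => √(h z)) x ^ 2 ∂ν' := by ring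
    _ ≤ _ := by gcongr

theorem densityMeasure_le_smul {β : ℝ} {f g : ℝ → ℝ} {r : NNReal} (hfm : Measurable f)
    (h : ∀ x, g x ≤ r * f x) : densityMeasure β g ≤ r • densityMeasure β f := by
  have h1 : r • densityMeasure β f =
      (gaussMeasure β).withDensity (fun x => r * ENNReal.ofReal (f x)) := by
    rw [densityMeasure, show (fun x => (r : ENNReal) * ENNReal.ofReal (f x)) =
      (r : ENNReal) • fun x => ENNReal.ofReal (f x) from rfl,
      withDensity_smul _ (by fun_prop)]
    rfl
  rw [h1]
  refine withDensity_mono (ae_of_all _ fun x => ?_)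
  show ENNReal.ofReal (g x) ≤ r * ENNReal.ofReal (f x)
  rw [← ENNReal.ofReal_coe_nnreal, ← ENNReal.ofReal_mul r.coe_nonneg]
  exact ENNReal.ofReal_le_ofReal (h x)

section tensor

variable {n : ℕ} {μ : Measure ℝ} [IsProbabilityMeasure μ] {a b : ℝ → ℝ}

/-- Telescoping over the coordinates: replacing one probability density by another in a product
costs at most the `L¹` distance in each coordinate. -/
theorem integral_abs_prod_sub_prod_le (ha : Integrable a μ) (hb : Integrable b μ)
    (ha0 : ∀ x, 0 ≤ a x) (hb0 : ∀ x, 0 ≤ b x) (ha1 : ∫ x, a x ∂μ = 1) (hb1 : ∫ x, b x ∂μ = 1) :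
    Integrable (fun x : Fin n → ℝ => |∏ i, a (x i) - ∏ i, b (x i)|) (Measure.pi fun _ => μ) ∧
      ∫ x : Fin n → ℝ, |∏ i, a (x i) - ∏ i, b (x i)| ∂(Measure.pi fun _ => μ) ≤
        n * ∫ x, |a x - b x| ∂μ := by
  have hia : Integrable (fun x : Fin n → ℝ => ∏ i, a (x i)) (Measure.pi fun _ => μ) :=
    Integrable.fintype_prod fun _ => ha
  have hib : Integrable (fun x : Fin n → ℝ => ∏ i, b (x i)) (Measure.pi fun _ => μ) :=
    Integrable.fintype_prod fun _ => hb
  refine ⟨(hia.sub hib).abs, ?_⟩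
  set F : Fin n → Fin n → ℝ → ℝ := fun i j y =>
    if j < i then b y else if j = i then |a y - b y| else a y with hF
  have hFi : ∀ i j, Integrable (F i j) μ := fun i j => by
    by_cases h1 : j < i
    · simpa [hF, h1] using hb
    by_cases h2 : j = i
    · simpa [hF, h2] using (ha.sub hb).abs
    · simpa [hF, h1, h2] using ha
  have hF1 : ∀ i j, ∫ y, F i j y ∂μ = if j = i then ∫ x, |a x - b x| ∂μ else 1 := fun i j => by
    by_cases h1 : j < i
    · simp [hF, h1, hb1, h1.ne]
    by_cases h2 : j = i
    · simp [hF, h2]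
    · simp [hF, h1, h2, ha1]
  have hFint : ∀ i, Integrable (fun x : Fin n → ℝ => ∏ j, F i j (x j)) (Measure.pi fun _ => μ) :=
    fun i => Integrable.fintype_prod (hFi i)
  have hpt : ∀ x : Fin n → ℝ, |∏ i, a (x i) - ∏ i, b (x i)| ≤ ∑ i, ∏ j, F i j (x j) := by
    intro x
    have h1 := Finset.prod_sub_ordered Finset.univ (fun i => a (x i))
      (fun i => a (x i) - b (x i))
    simp only [sub_sub_cancel] at h1
    rw [h1, sub_sub_cancel]
    refine (Finset.abs_sum_le_sum_abs _ _).trans (Finset.sum_le_sum fun i _ => le_of_eq ?_)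
    rw [abs_mul, abs_mul, abs_of_nonneg (Finset.prod_nonneg fun j _ => hb0 _),
      abs_of_nonneg (Finset.prod_nonneg fun j _ => ha0 _)]
    have h2 : ∀ j, F i j (x j) = (if j = i then |a (x i) - b (x i)| else 1) *
        (if j < i then b (x j) else 1) * (if i < j then a (x j) else 1) := fun j => by
      rcases lt_trichotomy j i with h | h | h
      · simp [hF, h, h.ne, h.not_gt]
      · simp [hF, h]
      · simp [hF, h, h.ne', h.not_gt]
    simp only [h2, Finset.prod_mul_distrib, Finset.prod_ite_eq', Finset.mem_univ, if_true,
      Finset.prod_filter]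
  calc ∫ x : Fin n → ℝ, |∏ i, a (x i) - ∏ i, b (x i)| ∂(Measure.pi fun _ => μ)
      ≤ ∫ x : Fin n → ℝ, ∑ i, ∏ j, F i j (x j) ∂(Measure.pi fun _ => μ) :=
        integral_mono (hia.sub hib).abs (integrable_finsetSum _ fun i _ => hFint i) hpt
    _ = ∑ i : Fin n, ∫ x, |a x - b x| ∂μ := by
        rw [integral_finsetSum _ fun i _ => hFint i]
        refine Finset.sum_congr rfl fun i _ => ?_
        rw [integral_fintype_prod_eq_prod]
        simp [hF1]
    _ = n * ∫ x, |a x - b x| ∂μ := by simp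

theorem ouSemigroupPi_tensorPow (β t : ℝ) (f : ℝ → ℝ) (x : Fin n → ℝ) :
    ouSemigroupPi β t (tensorPow n f) x = ∏ i, ouSemigroup β t f (x i) := by
  simp only [ouSemigroupPi, tensorPow, ouSemigroup]
  exact integral_fintype_prod_eq_prod (fun _ => f)

end tensor

/-! ### Powers of the generator applied to `exp (-V)` -/

/-- A family of `r` times continuously differentiable functions whose derivatives of order at most
`r` satisfy polynomial bounds that are uniform over the family. -/
def UniformPolyGrowth {ι : Type*} : ℕ → (ι → ℝ → ℝ) → Prop
  | 0, P => (∀ i, Continuous (P i)) ∧ ∃ A : ℝ, ∃ m : ℕ, ∀ i x, |P i x| ≤ A * (1 + x ^ 2) ^ m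
  | r + 1, P => (∀ i, Differentiable ℝ (P i)) ∧
      (∃ A : ℝ, ∃ m : ℕ, ∀ i x, |P i x| ≤ A * (1 + x ^ 2) ^ m) ∧
      UniformPolyGrowth r fun i => deriv (P i)

namespace UniformPolyGrowth

variable {ι : Type*} {P Q : ι → ℝ → ℝ} {r : ℕ}

theorem exists_bound (h : UniformPolyGrowth r P) :
    ∃ A : ℝ, 0 ≤ A ∧ ∃ m : ℕ, ∀ i x, |P i x| ≤ A * (1 + x ^ 2) ^ m := by
  have : ∃ A : ℝ, ∃ m : ℕ, ∀ i x, |P i x| ≤ A * (1 + x ^ 2) ^ m := by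
    cases r with
    | zero => exact h.2
    | succ r => exact h.2.1
  obtain ⟨A, m, hA⟩ := this
  exact ⟨|A|, abs_nonneg A, m, fun i x => (hA i x).trans (by gcongr; exact le_abs_self A)⟩

theorem continuous (h : UniformPolyGrowth r P) (i : ι) : Continuous (P i) := by
  cases r with
  | zero => exact h.1 i
  | succ r => exact (h.1 i).continuous

theorem contDiff (h : UniformPolyGrowth r P) (i : ι) : ContDiff ℝ r (P i) := by
  induction r generalizing P with
  | zero => exact contDiff_zero.2 (h.1 i)
  | succ r ih =>
    rw [Nat.cast_succ]
    exact contDiff_succ_iff_deriv.2 ⟨h.1 i, by simp, ih h.2.2⟩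

theorem of_succ (h : UniformPolyGrowth (r + 1) P) : UniformPolyGrowth r P := by
  induction r generalizing P with
  | zero => exact ⟨fun i => (h.1 i).continuous, h.2.1⟩
  | succ r ih => exact ⟨h.1, h.2.1, ih h.2.2⟩

theorem mono (h : UniformPolyGrowth r P) {s : ℕ} (hs : s ≤ r) : UniformPolyGrowth s P := by
  induction hs with
  | refl => exact h
  | step _ ih => exact ih h.of_succ

theorem add (hP : UniformPolyGrowth r P) (hQ : UniformPolyGrowth r Q) :
    UniformPolyGrowth r fun i x => P i x + Q i x := by
  have hb {r : ℕ} {P Q : ι → ℝ → ℝ} (hP : UniformPolyGrowth r P) (hQ : UniformPolyGrowth r Q) :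
      ∃ A : ℝ, ∃ m : ℕ, ∀ i x, |P i x + Q i x| ≤ A * (1 + x ^ 2) ^ m := by
    obtain ⟨A, hA, m, h₁⟩ := hP.exists_bound
    obtain ⟨B, hB, k, h₂⟩ := hQ.exists_bound
    refine ⟨A + B, m + k, fun i x => (abs_add_le _ _).trans ?_⟩
    have h1 : (1 : ℝ) ≤ 1 + x ^ 2 := by nlinarith [sq_nonneg x]
    rw [add_mul]
    refine add_le_add ((h₁ i x).trans ?_) ((h₂ i x).trans ?_) <;> gcongr <;> omega
  induction r generalizing P Q with
  | zero => exact ⟨fun i => (hP.1 i).add (hQ.1 i), hb hP hQ⟩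
  | succ r ih =>
    refine ⟨fun i => (hP.1 i).add (hQ.1 i), hb hP hQ, ?_⟩
    have e : (fun i => deriv fun x => P i x + Q i x) = fun i x => deriv (P i) x + deriv (Q i) x :=
      funext fun i => funext fun x => deriv_fun_add (hP.1 i x) (hQ.1 i x)
    rw [e]
    exact ih hP.2.2 hQ.2.2

theorem mul (hP : UniformPolyGrowth r P) (hQ : UniformPolyGrowth r Q) :
    UniformPolyGrowth r fun i x => P i x * Q i x := by
  have hb {r : ℕ} {P Q : ι → ℝ → ℝ} (hP : UniformPolyGrowth r P) (hQ : UniformPolyGrowth r Q) :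
      ∃ A : ℝ, ∃ m : ℕ, ∀ i x, |P i x * Q i x| ≤ A * (1 + x ^ 2) ^ m := by
    obtain ⟨A, hA, m, h₁⟩ := hP.exists_bound
    obtain ⟨B, hB, k, h₂⟩ := hQ.exists_bound
    refine ⟨A * B, m + k, fun i x => ?_⟩
    rw [abs_mul, pow_add, mul_mul_mul_comm]
    exact mul_le_mul (h₁ i x) (h₂ i x) (abs_nonneg _) (by positivity)
  induction r generalizing P Q with
  | zero => exact ⟨fun i => (hP.1 i).mul (hQ.1 i), hb hP hQ⟩
  | succ r ih =>
    refine ⟨fun i => (hP.1 i).mul (hQ.1 i), hb hP hQ, ?_⟩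
    have e : (fun i => deriv fun x => P i x * Q i x) =
        fun i x => deriv (P i) x * Q i x + P i x * deriv (Q i) x :=
      funext fun i => funext fun x => deriv_fun_mul (hP.1 i x) (hQ.1 i x)
    rw [e]
    exact (ih hP.2.2 hQ.of_succ).add (ih hP.of_succ hQ.2.2)

theorem const (r : ℕ) (a : ℝ) : UniformPolyGrowth r fun (_ : ι) _ => a := by
  have hb : ∀ a : ℝ, ∃ A : ℝ, ∃ m : ℕ, ∀ (_ : ι) (x : ℝ), |a| ≤ A * (1 + x ^ 2) ^ m :=
    fun a => ⟨|a|, 0, by simp⟩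
  induction r generalizing a with
  | zero => exact ⟨fun _ => continuous_const, hb a⟩
  | succ r ih => exact ⟨fun _ => differentiable_const a, hb a, by simpa using ih 0⟩

theorem id (r : ℕ) : UniformPolyGrowth r fun (_ : ι) x => x := by
  have hb : ∃ A : ℝ, ∃ m : ℕ, ∀ (_ : ι) (x : ℝ), |x| ≤ A * (1 + x ^ 2) ^ m :=
    ⟨1, 1, fun _ x => by simpa using abs_le_one_add_sq x⟩
  cases r with
  | zero => exact ⟨fun _ => continuous_id, hb⟩
  | succ r => exact ⟨fun _ => differentiable_id, hb, by simpa using const r 1⟩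

theorem of_iteratedDeriv {A : ℝ} {m : ℕ} (hc : ∀ i, ContDiff ℝ r (P i))
    (hb : ∀ j ≤ r, ∀ i x, |iteratedDeriv j (P i) x| ≤ A * (1 + x ^ 2) ^ m) :
    UniformPolyGrowth r P := by
  induction r generalizing P with
  | zero => exact ⟨fun i => (hc i).continuous, A, m, by simpa using hb 0 le_rfl⟩
  | succ r ih =>
    refine ⟨fun i => (hc i).differentiable (by simp), ⟨A, m, by simpa using hb 0 (Nat.zero_le _)⟩,
      ih (fun i => ?_) fun j hj i x => ?_⟩
    · have := hc i
      rw [Nat.cast_succ] at this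
      exact (contDiff_succ_iff_deriv.1 this).2.2
    · rw [← iteratedDeriv_succ']
      exact hb (j + 1) (by omega) i x

end UniformPolyGrowth

/-- The generator conjugated by the weight `exp (-V)`:
`B (P exp (-V)) = (conjGenerator β V P) exp (-V)`. -/
def conjGenerator (β : ℝ) (V P : ℝ → ℝ) (x : ℝ) : ℝ :=
  1 / 2 * (deriv (deriv P) x + -2 * (deriv V x * deriv P x) +
    (deriv V x * deriv V x + -1 * deriv (deriv V) x) * P x) +
    (-(β / 2)) * (x * (deriv P x + -1 * (deriv V x * P x)))

/-- The factor `Pₖ` in `B ^ k exp (-V) = Pₖ exp (-V)`, a polynomial in the derivatives of `V` up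
to order `2 k` and in `x`. -/
def genFactor (β : ℝ) (V : ℝ → ℝ) : ℕ → ℝ → ℝ
  | 0 => fun _ => 1
  | k + 1 => conjGenerator β V (genFactor β V k)

theorem UniformPolyGrowth.conjGenerator {ι : Type*} {V P : ι → ℝ → ℝ} {r : ℕ} (β : ℝ)
    (hV : UniformPolyGrowth (r + 1) fun i => deriv (V i)) (hP : UniformPolyGrowth (r + 2) P) :
    UniformPolyGrowth r fun i => conjGenerator β (V i) (P i) := by
  have hP0 := hP.of_succ.of_succ
  have hP1 : UniformPolyGrowth r fun i => deriv (P i) := hP.2.2.of_succ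
  have hP2 : UniformPolyGrowth r fun i => deriv (deriv (P i)) := hP.2.2.2.2
  have hV1 := hV.of_succ
  have hV2 : UniformPolyGrowth r fun i => deriv (deriv (V i)) := hV.2.2
  exact ((const r _).mul ((hP2.add ((const r _).mul (hV1.mul hP1))).add
    (((hV1.mul hV1).add ((const r _).mul hV2)).mul hP0))).add
    ((const r _).mul ((id r).mul (hP1.add ((const r _).mul (hV1.mul hP0)))))

theorem UniformPolyGrowth.genFactor {ι : Type*} {V : ι → ℝ → ℝ} (β : ℝ) {K : ℕ} (hK : 1 ≤ K)
    (hV : UniformPolyGrowth (2 * K - 1) fun i => deriv (V i)) {k : ℕ} (hk : k ≤ K) :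
    UniformPolyGrowth (2 * K - 2 * k) fun i => genFactor β (V i) k := by
  induction k with
  | zero => exact const _ 1
  | succ k ih =>
    exact UniformPolyGrowth.conjGenerator β (hV.mono (by omega)) ((ih (by omega)).mono (by omega))

theorem hasDerivAt_mul_exp_neg {V P : ℝ → ℝ} {x : ℝ} {V' P' : ℝ} (hV : HasDerivAt V V' x)
    (hP : HasDerivAt P P' x) :
    HasDerivAt (fun x => P x * Real.exp (-V x)) ((P' - V' * P x) * Real.exp (-V x)) x :=
  (hP.mul hV.neg.exp).congr_deriv (by simp; ring)

theorem deriv_mul_exp_neg {V P : ℝ → ℝ} (hV : ContDiff ℝ 2 V) (hP : ContDiff ℝ 2 P) :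
    deriv (fun x => P x * Real.exp (-V x)) =
      fun x => (deriv P x - deriv V x * P x) * Real.exp (-V x) :=
  funext fun x => (hasDerivAt_mul_exp_neg (hV.hasDerivAt_of_two x) (hP.hasDerivAt_of_two x)).deriv

theorem deriv_deriv_mul_exp_neg {V P : ℝ → ℝ} (hV : ContDiff ℝ 2 V) (hP : ContDiff ℝ 2 P) :
    deriv (deriv fun x => P x * Real.exp (-V x)) =
      fun x => (deriv (deriv P) x - (deriv (deriv V) x * P x + deriv V x * deriv P x) -
        deriv V x * (deriv P x - deriv V x * P x)) * Real.exp (-V x) := by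
  rw [deriv_mul_exp_neg hV hP]
  exact funext fun x => (hasDerivAt_mul_exp_neg (hV.hasDerivAt_of_two x)
    ((hP.hasDerivAt_deriv_of_two x).sub
      ((hV.hasDerivAt_deriv_of_two x).mul (hP.hasDerivAt_of_two x)))).deriv

theorem ouGenerator_mul_exp_neg (β : ℝ) {V P : ℝ → ℝ} (hV : ContDiff ℝ 2 V)
    (hP : ContDiff ℝ 2 P) :
    ouGenerator β (fun x => P x * Real.exp (-V x)) =
      fun x => conjGenerator β V P x * Real.exp (-V x) := by
  funext x
  rw [ouGenerator, deriv_deriv_mul_exp_neg hV hP, deriv_mul_exp_neg hV hP, conjGenerator]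
  ring

/-- A function `P` of polynomial growth times the density `exp (-V)` is smooth with all moments as
soon as the density has all moments. -/
theorem SmoothAllMoments.mul_exp_neg {β : ℝ} {ι : Type*} {V P : ι → ℝ → ℝ}
    (hV : UniformPolyGrowth 1 fun i => deriv (V i)) (hP : UniformPolyGrowth 2 P) (i : ι)
    (hVc : ContDiff ℝ 2 (V i)) (hu : HasAllMoments β fun x => Real.exp (-V i x)) :
    SmoothAllMoments β fun x => P i x * Real.exp (-V i x) := by
  have key {Q : ι → ℝ → ℝ} (hQ : UniformPolyGrowth 0 Q) :
      HasAllMoments β fun x => Q i x * Real.exp (-V i x) := by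
    obtain ⟨A, -, m, h⟩ := hQ.exists_bound
    exact hu.mul (hQ.continuous i).measurable (h i)
  have hPc : ContDiff ℝ 2 (P i) := hP.contDiff i
  have hP0 := hP.of_succ.of_succ
  have hP1 : UniformPolyGrowth 0 fun i => deriv (P i) := hP.2.2.of_succ
  have hP2 : UniformPolyGrowth 0 fun i => deriv (deriv (P i)) := hP.2.2.2.2
  have hV1 := hV.of_succ
  have hV2 : UniformPolyGrowth 0 fun i => deriv (deriv (V i)) := hV.2.2
  have hVP := (UniformPolyGrowth.const 0 (-1)).mul (hV1.mul hP0)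
  refine ⟨hPc.mul hVc.neg.exp, key hP0, ?_, ?_⟩
  · rw [deriv_mul_exp_neg hVc hPc]
    simpa only [neg_mul, one_mul, ← sub_eq_add_neg] using key (hP1.add hVP)
  · rw [deriv_deriv_mul_exp_neg hVc hPc]
    simpa only [neg_mul, one_mul, ← sub_eq_add_neg] using
      key ((hP2.add ((UniformPolyGrowth.const 0 (-1)).mul ((hV2.mul hP0).add (hV1.mul hP1)))).add
        ((UniformPolyGrowth.const 0 (-1)).mul (hV1.mul (hP1.add hVP))))

/-! ### Moments and perturbation of normalized densities -/

theorem integrable_densityMeasure_iff {u φ : ℝ → ℝ} (hm : Measurable u) (h0 : ∀ x, 0 ≤ u x) :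
    Integrable φ (densityMeasure β u) ↔ Integrable (fun x => u x * φ x) (gaussMeasure β) := by
  rw [densityMeasure, integrable_withDensity_iff_integrable_smul' (by fun_prop)
    (ae_of_all _ fun _ => ENNReal.ofReal_lt_top)]
  simp only [ENNReal.toReal_ofReal (h0 _), smul_eq_mul]

theorem integral_densityMeasure {u : ℝ → ℝ} (hm : Measurable u) (h0 : ∀ x, 0 ≤ u x)
    (φ : ℝ → ℝ) :
    ∫ x, φ x ∂(densityMeasure β u) = ∫ x, u x * φ x ∂(gaussMeasure β) := by
  rw [densityMeasure, integral_withDensity_eq_integral_toReal_smul (by fun_prop)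
    (ae_of_all _ fun _ => ENNReal.ofReal_lt_top)]
  simp only [ENNReal.toReal_ofReal (h0 _), smul_eq_mul]

namespace IsNormalizedDensity

variable {u : ℝ → ℝ}

theorem integrable (h : IsNormalizedDensity β u) : Integrable u (gaussMeasure β) := by
  have := h.isProb
  simpa using (integrable_densityMeasure_iff h.measurable h.nonneg).1
    (integrable_const (μ := densityMeasure β u) (1 : ℝ))

theorem integral_eq_one (h : IsNormalizedDensity β u) : ∫ x, u x ∂(gaussMeasure β) = 1 := by
  have := h.isProb
  simpa using (integral_densityMeasure h.measurable h.nonneg (β := β) fun _ => 1).symm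

theorem integral_id_mul (h : IsNormalizedDensity β u) :
    ∫ x, x * u x ∂(gaussMeasure β) = 0 := by
  simpa only [mul_comm (u _)] using
    (integral_densityMeasure h.measurable h.nonneg _).symm.trans h.mean

theorem integrable_sq_mul (h : IsNormalizedDensity β u) :
    Integrable (fun x => x ^ 2 * u x) (gaussMeasure β) := by
  simpa only [mul_comm (u _)] using
    (integrable_densityMeasure_iff h.measurable h.nonneg).1 h.memLp.integrable_sq

theorem integral_sq_mul (h : IsNormalizedDensity β u) :
    ∫ x, x ^ 2 * u x ∂(gaussMeasure β) = 1 / β := by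
  have := h.variance
  rw [variance_of_integral_eq_zero (by fun_prop) h.mean,
    integral_densityMeasure h.measurable h.nonneg] at this
  simpa only [mul_comm (u _)] using this

theorem of_moments (hm : Measurable u) (h0 : ∀ x, 0 ≤ u x)
    (hi : Integrable u (gaussMeasure β))
    (hi2 : Integrable (fun x => x ^ 2 * u x) (gaussMeasure β))
    (h1 : ∫ x, u x ∂(gaussMeasure β) = 1) (hx : ∫ x, x * u x ∂(gaussMeasure β) = 0)
    (hx2 : ∫ x, x ^ 2 * u x ∂(gaussMeasure β) = 1 / β) : IsNormalizedDensity β u := by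
  have hmean : ∫ x, x ∂(densityMeasure β u) = 0 := by
    rw [integral_densityMeasure hm h0]
    simpa only [mul_comm (u _)] using hx
  refine ⟨hm, h0, ⟨?_⟩, ?_, hmean, ?_⟩
  · rw [densityMeasure, withDensity_apply _ .univ, setLIntegral_univ,
      ← ofReal_integral_eq_lintegral_ofReal hi (ae_of_all _ h0), h1, ENNReal.ofReal_one]
  · rw [memLp_two_iff_integrable_sq (by fun_prop), integrable_densityMeasure_iff hm h0]
    simpa only [mul_comm (u _)] using hi2
  · rw [variance_of_integral_eq_zero (by fun_prop) hmean, integral_densityMeasure hm h0]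
    simpa only [mul_comm (u _)] using hx2

end IsNormalizedDensity

theorem exists_one_add_sq_pow_le_exp {δ a : ℝ} (hδ : 0 < δ) (ha : 0 < a) (p : ℕ) :
    ∃ C : ℝ, 0 ≤ C ∧ ∀ x : ℝ, (1 + x ^ 2) ^ p ≤ C * Real.exp (δ * |x| ^ a) := by
  obtain ⟨n, hn⟩ := exists_nat_ge (2 * p / a)
  refine ⟨2 ^ p * (1 + n.factorial / δ ^ n), by positivity, fun x => ?_⟩
  have hy : 0 ≤ |x| ^ a := Real.rpow_nonneg (abs_nonneg x) a
  have hexp1 : 1 ≤ Real.exp (δ * |x| ^ a) := Real.one_le_exp (by positivity)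
  have hexp0 := Real.exp_pos (δ * |x| ^ a)
  have hpow : (|x| ^ 2) ^ p ≤ 1 ∨ 1 ≤ |x| := by
    rcases le_total 1 |x| with h | h
    · exact .inr h
    · exact .inl (pow_le_one₀ (by positivity) (pow_le_one₀ (abs_nonneg x) h))
  rw [← sq_abs x]
  have hq : 0 ≤ n.factorial / δ ^ n * Real.exp (δ * |x| ^ a) := by positivity
  rcases le_total |x| 1 with h | h
  · calc (1 + |x| ^ 2) ^ p ≤ 2 ^ p := by
          gcongr
          nlinarith [pow_le_one₀ (abs_nonneg x) h (n := 2)]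
      _ ≤ 2 ^ p * (1 + n.factorial / δ ^ n) * 1 := by
          rw [mul_one]
          exact le_mul_of_one_le_right (by positivity) (by simp; positivity)
      _ ≤ _ := by gcongr
  · have h1 : (|x| ^ 2) ^ p ≤ (|x| ^ a) ^ n := by
      rw [← pow_mul, ← Real.rpow_natCast, ← Real.rpow_natCast, ← Real.rpow_mul (abs_nonneg x)]
      refine Real.rpow_le_rpow_of_exponent_le h ?_
      rw [div_le_iff₀ ha] at hn
      push_cast
      linarith
    have h2 : (δ * |x| ^ a) ^ n ≤ n.factorial * Real.exp (δ * |x| ^ a) := by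
      have := Real.pow_div_factorial_le_exp (δ * |x| ^ a) (by positivity) n
      rwa [div_le_iff₀' (by positivity)] at this
    calc (1 + |x| ^ 2) ^ p ≤ (2 * |x| ^ 2) ^ p := by
          gcongr
          nlinarith [one_le_pow₀ h (n := 2)]
      _ = 2 ^ p * (|x| ^ 2) ^ p := mul_pow _ _ _
      _ ≤ 2 ^ p * (n.factorial / δ ^ n * Real.exp (δ * |x| ^ a)) := by
          gcongr
          refine h1.trans ?_
          rw [div_mul_eq_mul_div, le_div_iff₀ (by positivity), mul_comm, ← mul_pow]
          exact h2
      _ ≤ _ := by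
          rw [mul_assoc, add_mul, one_mul]
          gcongr
          linarith

/-- An exponential moment of `u γ` bounds all its polynomial moments. -/
theorem exists_moment_bound (β : ℝ) {δ a : ℝ} (hδ : 0 < δ) (ha : 0 < a) (M : ℝ) (p : ℕ) :
    ∃ S : ℝ, 0 ≤ S ∧ ∀ u : ℝ → ℝ, IsNormalizedDensity β u →
      Integrable (fun x => Real.exp (δ * |x| ^ a)) (densityMeasure β u) →
      ∫ x, Real.exp (δ * |x| ^ a) ∂(densityMeasure β u) ≤ M →
      Integrable (fun x => (1 + x ^ 2) ^ p * u x) (gaussMeasure β) ∧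
        ∫ x, (1 + x ^ 2) ^ p * u x ∂(gaussMeasure β) ≤ S := by
  obtain ⟨C, hC, h⟩ := exists_one_add_sq_pow_le_exp hδ ha p
  refine ⟨C * |M|, by positivity, fun u hu hi hM => ?_⟩
  have := hu.measurable
  rw [integrable_densityMeasure_iff hu.measurable hu.nonneg] at hi
  rw [integral_densityMeasure hu.measurable hu.nonneg] at hM
  have hle : ∀ x, (1 + x ^ 2) ^ p * u x ≤ C * (u x * Real.exp (δ * |x| ^ a)) := fun x => by
    calc _ ≤ C * Real.exp (δ * |x| ^ a) * u x := by gcongr; exacts [hu.nonneg x, h x]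
      _ = _ := by ring
  have hI : Integrable (fun x => (1 + x ^ 2) ^ p * u x) (gaussMeasure β) := by
    refine (hi.const_mul C).mono' (by fun_prop) (ae_of_all _ fun x => ?_)
    rw [Real.norm_of_nonneg (mul_nonneg (by positivity) (hu.nonneg x))]
    exact hle x
  refine ⟨hI, (integral_mono hI (hi.const_mul C) hle).trans ?_⟩
  rw [integral_const_mul]
  gcongr
  exact hM.trans (le_abs_self M)

/-- Densities of variance `1 / β` with `|V'|` of a given polynomial growth are bounded below on
`[-1, 1]`: at least half of the mass sits in a fixed interval, on which `V` oscillates by a bounded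
amount. -/
theorem exists_lower_bound (hβ : 0 < β) {A : ℝ} (hA : 0 ≤ A) (m : ℕ) :
    ∃ κ : ℝ, 0 < κ ∧ ∀ V : ℝ → ℝ, IsNormalizedDensity β (fun x => Real.exp (-V x)) →
      Differentiable ℝ V → (∀ x, |deriv V x| ≤ A * (1 + x ^ 2) ^ m) →
      ∀ x, |x| ≤ 1 → κ ≤ Real.exp (-V x) := by
  set R : ℝ := 1 + 2 / β with hR
  have hR0 : 0 < 2 / β := by positivity
  have hR1 : 1 ≤ R := by linarith
  have hR2 : 2 / β ≤ R ^ 2 := by nlinarith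
  set B := A * (1 + R ^ 2) ^ m with hB
  have hB0 : 0 ≤ B := by positivity
  refine ⟨Real.exp (-(B * (2 * R))) / 2, by positivity, fun V hu hV hVb x hx => ?_⟩
  have hosc : ∀ y, |y| ≤ R → V x - V y ≤ B * (2 * R) := fun y hy => by
    have h1 := (convex_Icc (-R) R).norm_image_sub_le_of_norm_deriv_le (f := V) (C := B)
      (fun z _ => hV z) (fun z hz => (hVb z).trans ?_) (abs_le.1 hy) (abs_le.1 (hx.trans hR1))
    · have h2 : |x - y| ≤ 2 * R := (abs_sub _ _).trans (by linarith)
      exact (le_abs_self _).trans (h1.trans (by gcongr; exact h2))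
    · have : z ^ 2 ≤ R ^ 2 := sq_le_sq' hz.1 hz.2
      rw [hB]
      gcongr
  have hpt : ∀ y, Real.exp (-V y) ≤
      Real.exp (B * (2 * R)) * Real.exp (-V x) + β / 2 * (y ^ 2 * Real.exp (-V y)) := fun y => by
    rcases le_or_gt |y| R with hy | hy
    · have h1 : Real.exp (-V y) ≤ Real.exp (B * (2 * R)) * Real.exp (-V x) := by
        rw [← Real.exp_add]
        exact Real.exp_le_exp.2 (by linarith [hosc y hy])
      have h2 : 0 ≤ β / 2 * (y ^ 2 * Real.exp (-V y)) := by positivity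
      linarith
    · have h1 : 1 ≤ β / 2 * y ^ 2 := by
        have h3 : R ^ 2 ≤ y ^ 2 := by rw [← sq_abs y]; gcongr
        rw [div_le_iff₀ hβ] at hR2
        nlinarith
      have h2 := mul_le_mul_of_nonneg_right h1 (Real.exp_pos (-V y)).le
      have h3 : 0 ≤ Real.exp (B * (2 * R)) * Real.exp (-V x) := by positivity
      linarith
  have hint := integral_mono hu.integrable
    ((integrable_const _).add (hu.integrable_sq_mul.const_mul (β / 2))) hpt
  simp only [Pi.add_apply] at hint
  rw [hu.integral_eq_one, integral_add (integrable_const _)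
    (hu.integrable_sq_mul.const_mul (β / 2)), integral_const_mul (β / 2), hu.integral_sq_mul] at hint
  have h4 : β / 2 * (1 / β) = 1 / 2 := by field_simp
  rw [h4] at hint
  simp only [integral_const, probReal_univ, one_smul] at hint
  rw [Real.exp_neg (B * (2 * R)), ← one_div, div_div, div_le_iff₀ (by positivity)]
  nlinarith

theorem gaussPDF_one_le (hβ : 0 < β) {x : ℝ} (hx : |x| ≤ 1) : gaussPDF β 1 ≤ gaussPDF β x := by
  have hv : ((1 / β).toNNReal : ℝ) = 1 / β := Real.coe_toNNReal _ (by positivity)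
  have : x ^ 2 ≤ 1 ^ 2 := by rw [← sq_abs]; gcongr
  simp only [gaussPDF, gaussianPDFReal, hv, sub_zero]
  gcongr _ * Real.exp (-?_ / _)

/-- A density that is bounded below on `[-1, 1]` can be perturbed there by a bounded relative
amount so as to change its mass and its first two moments by prescribed values. -/
theorem exists_moment_corrector (hβ : 0 < β) {κ : ℝ} (hκ : 0 < κ) :
    ∃ C : ℝ, 0 ≤ C ∧ ∀ u : ℝ → ℝ, Measurable u → (∀ x, |x| ≤ 1 → κ ≤ u x) →
      ∀ e₀ e₁ e₂ η : ℝ, |e₀| ≤ η → |e₁| ≤ η → |e₂| ≤ η →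
        ∃ ψ : ℝ → ℝ, Measurable ψ ∧ (∀ x, |ψ x| ≤ C * η) ∧
          ∫ x, ψ x * u x ∂(gaussMeasure β) = e₀ ∧
          ∫ x, x * (ψ x * u x) ∂(gaussMeasure β) = e₁ ∧
          ∫ x, x ^ 2 * (ψ x * u x) ∂(gaussMeasure β) = e₂ := by
  have hg := gaussPDF_pos hβ 1
  refine ⟨12 / (κ * gaussPDF β 1), by positivity, fun u hm hu e₀ e₁ e₂ η h₀ h₁ h₂ => ?_⟩
  have hη : 0 ≤ η := (abs_nonneg _).trans h₀
  -- the quadratic polynomial whose moments of order 0, 1, 2 over `[-1, 1]` are `e₀, e₁, e₂`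
  set p : ℝ → ℝ := fun x => (9 / 8 * e₀ - 15 / 8 * e₂) + 3 / 2 * e₁ * x +
    (45 / 8 * e₂ - 15 / 8 * e₀) * x ^ 2 with hp
  have hpb : ∀ x, |x| ≤ 1 → |p x| ≤ 12 * η := fun x hx => by
    have hx2 : x ^ 2 ≤ 1 := by rw [← sq_abs]; exact pow_le_one₀ (abs_nonneg x) hx
    have b1 : |3 / 2 * e₁ * x| ≤ 3 / 2 * η * 1 := by
      rw [abs_mul, abs_mul, abs_of_pos (by norm_num : (0 : ℝ) < 3 / 2)]; gcongr
    have b2 : |(45 / 8 * e₂ - 15 / 8 * e₀) * x ^ 2| ≤ 15 / 2 * η * 1 := by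
      rw [abs_mul, abs_of_nonneg (sq_nonneg x)]
      gcongr
      rw [abs_le] at *
      constructor <;> linarith
    rw [abs_le] at *
    simp only [hp]
    constructor <;> linarith
  set ψ : ℝ → ℝ := (Set.Icc (-1) 1).indicator fun x => p x / (u x * gaussPDF β x) with hψ
  have key : ∀ w : ℝ → ℝ, ∫ x, w x * (ψ x * u x) ∂(gaussMeasure β) =
      ∫ x in (-1 : ℝ)..1, w x * p x := fun w => by
    rw [integral_gaussMeasure hβ, intervalIntegral.integral_of_le (by norm_num),
      ← integral_Icc_eq_integral_Ioc, ← integral_indicator measurableSet_Icc]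
    refine integral_congr_ae (ae_of_all _ fun x => ?_)
    by_cases hx : x ∈ Set.Icc (-1 : ℝ) 1
    · have h1 := hκ.trans_le (hu x (abs_le.2 hx))
      have h2 := gaussPDF_pos hβ x
      simp only [hψ, Set.indicator_of_mem hx]
      field_simp
    · simp [hψ, Set.indicator_of_notMem hx]
  have mom : ∀ k : ℕ, ∫ x in (-1 : ℝ)..1, x ^ k * p x =
      (9 / 8 * e₀ - 15 / 8 * e₂) * ((1 - (-1) ^ (k + 1)) / (k + 1)) +
      3 / 2 * e₁ * ((1 - (-1) ^ (k + 2)) / (k + 2)) +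
      (45 / 8 * e₂ - 15 / 8 * e₀) * ((1 - (-1) ^ (k + 3)) / (k + 3)) := fun k => by
    have e : ∀ x : ℝ, x ^ k * p x = (9 / 8 * e₀ - 15 / 8 * e₂) * x ^ k +
        3 / 2 * e₁ * x ^ (k + 1) + (45 / 8 * e₂ - 15 / 8 * e₀) * x ^ (k + 2) := fun x => by
      simp only [hp]; ring
    simp only [e]
    have hi (c : ℝ) (j : ℕ) : IntervalIntegrable (fun x => c * x ^ j) volume (-1) 1 :=
      (continuous_const.mul (continuous_pow j)).intervalIntegrable _ _
    rw [intervalIntegral.integral_add ((hi _ _).add (hi _ _)) (hi _ _),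
      intervalIntegral.integral_add (hi _ _) (hi _ _)]
    simp only [intervalIntegral.integral_const_mul, integral_pow]
    push_cast
    ring
  refine ⟨ψ, ?_, fun x => ?_, ?_, ?_, ?_⟩
  · refine Measurable.indicator ?_ measurableSet_Icc
    exact Measurable.div (by fun_prop) (hm.mul measurable_gaussPDF)
  · by_cases hx : x ∈ Set.Icc (-1 : ℝ) 1
    · have hx' := abs_le.2 hx
      have h1 := hu x hx'
      have h2 := gaussPDF_one_le hβ hx'
      rw [hψ, Set.indicator_of_mem hx, abs_div,
        abs_of_pos (mul_pos (hκ.trans_le h1) (hg.trans_le h2))]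
      calc _ ≤ 12 * η / (κ * gaussPDF β 1) := by
            have h3 := hκ.le.trans h1
            gcongr
            exact hpb x hx'
        _ = _ := by ring
    · rw [hψ, Set.indicator_of_notMem hx, abs_zero]
      positivity
  · have := (key fun x => x ^ 0).trans (mom 0)
    norm_num at this
    rw [this]; ring
  · have := (key fun x => x ^ 1).trans (mom 1)
    norm_num at this
    rw [this]; ring
  · have := (key fun x => x ^ 2).trans (mom 2)
    norm_num at this
    rw [this]; ring

section generatorMoments

variable {f : ℝ → ℝ}

theorem deriv_sq_fun : deriv (fun x : ℝ => x ^ 2) = fun x => 2 * x := by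
  funext x; simp

theorem twiceTempered_one : TwiceTempered (fun _ => 1) 1 0 :=
  ⟨contDiff_const, by simp, by simp, by simp⟩

theorem twiceTempered_id : TwiceTempered (fun x => x) 1 1 := by
  refine ⟨contDiff_id, fun x => by simpa using abs_le_one_add_sq x, fun x => ?_, fun x => ?_⟩
  · simp [sq_nonneg]
  · simp; positivity

theorem twiceTempered_sq : TwiceTempered (fun x => x ^ 2) 2 1 := by
  refine ⟨contDiff_id.pow 2, fun x => ?_, fun x => ?_, fun x => ?_⟩
  · rw [abs_of_nonneg (sq_nonneg x)]; nlinarith [sq_nonneg x]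
  · rw [deriv_sq_fun, abs_mul, abs_two, pow_one]
    gcongr
    exact abs_le_one_add_sq x
  · rw [deriv_sq_fun]
    have : deriv (fun x : ℝ => 2 * x) x = 2 := by simp
    rw [this, abs_two]
    nlinarith [sq_nonneg x]

theorem integral_ouGenerator_eq_zero (hβ : 0 < β) (hf : SmoothAllMoments β f) :
    ∫ x, ouGenerator β f x ∂(gaussMeasure β) = 0 := by
  have := integral_ouGenerator_mul hβ twiceTempered_one hf.contDiff hf.moments hf.moments_deriv
    hf.moments_deriv_deriv
  simpa [ouGenerator] using this.symm

theorem integral_id_mul_ouGenerator (hβ : 0 < β) (hf : SmoothAllMoments β f) :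
    ∫ x, x * ouGenerator β f x ∂(gaussMeasure β) =
      -(β / 2) * ∫ x, x * f x ∂(gaussMeasure β) := by
  rw [← integral_ouGenerator_mul hβ twiceTempered_id hf.contDiff hf.moments hf.moments_deriv
    hf.moments_deriv_deriv, ← integral_const_mul]
  refine integral_congr_ae (ae_of_all _ fun x => ?_)
  simp [ouGenerator]
  ring

theorem integral_sq_mul_ouGenerator (hβ : 0 < β) (hf : SmoothAllMoments β f) :
    ∫ x, x ^ 2 * ouGenerator β f x ∂(gaussMeasure β) =
      ∫ x, f x ∂(gaussMeasure β) - β * ∫ x, x ^ 2 * f x ∂(gaussMeasure β) := by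
  have hi : Integrable (fun x => x ^ 2 * f x) (gaussMeasure β) :=
    (hf.moments.mul (by fun_prop) twiceTempered_sq.bound).integrable_self
  rw [← integral_ouGenerator_mul hβ twiceTempered_sq hf.contDiff hf.moments hf.moments_deriv
    hf.moments_deriv_deriv, ← integral_const_mul, ← integral_sub hf.moments.integrable_self
    (hi.const_mul β)]
  refine integral_congr_ae (ae_of_all _ fun x => ?_)
  have h2 : deriv (fun x : ℝ => 2 * x) x = 2 := by simp
  simp only [ouGenerator, deriv_sq_fun, h2]
  ring

end generatorMoments

/-! ### Construction of the approximate preimage -/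

/-- Approximate inversion of `e^{tB}` in `L¹(γ)`: it suffices to be `L¹`-close to the truncated
exponential series of `-tB` applied to the target. -/
theorem integral_abs_ouSemigroup_sub_le (hβ : 0 < β) {K : ℕ} (hK : 1 ≤ K) {f : ℕ → ℝ → ℝ}
    (hf : ∀ k < K, SmoothAllMoments β (f k)) (hB : ∀ k < K, f (k + 1) = ouGenerator β (f k))
    {g : ℝ → ℝ} (hg : Integrable g (gaussMeasure β)) (hgm : Measurable g) {t : ℝ} (ht : 0 ≤ t) :
    ∫ x, |ouSemigroup β t g x - f 0 x| ∂(gaussMeasure β) ≤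
      t ^ K * ∫ x, |f K x| ∂(gaussMeasure β) +
        ∫ x, |g x - ∑ k ∈ Finset.range K, (-t) ^ k / k.factorial * f k x| ∂(gaussMeasure β) := by
  have h0 := (hf 0 hK).moments.integrable_self
  have hTg := integrable_ouSemigroup hβ ht hg hgm
  refine integral_abs_le_of_forall_test (hTg.sub h0) fun ψ A hψ hψ1 => ?_
  set T : ℝ → ℝ := fun x => ∑ k ∈ Finset.range K, (-t) ^ k / k.factorial * f k x with hT
  have hTi : Integrable T (gaussMeasure β) := integrable_finsetSum _ fun k hk =>
    (hf k (Finset.mem_range.1 hk)).moments.integrable_self.const_mul _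
  have hψm : Measurable ψ := hψ.contDiff.continuous.measurable
  have hTψm : Measurable (ouSemigroup β t ψ) :=
    (hψ.ouSemigroup hβ ht).contDiff.continuous.measurable
  have hTψ1 : ∀ x, |ouSemigroup β t ψ x| ≤ 1 := abs_ouSemigroup_le hψ1
  have bdd {χ h : ℝ → ℝ} (hχ : Measurable χ) (hχ1 : ∀ x, |χ x| ≤ 1)
      (hh : Integrable h (gaussMeasure β)) : Integrable (fun x => χ x * h x) (gaussMeasure β) :=
    hh.bdd_mul hχ.aestronglyMeasurable (ae_of_all _ hχ1)
  have e1 : ∫ x, ψ x * (ouSemigroup β t g x - f 0 x) ∂(gaussMeasure β) =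
      (∫ x, ouSemigroup β t ψ x * T x ∂(gaussMeasure β) -
        ∫ x, ψ x * f 0 x ∂(gaussMeasure β)) +
      ∫ x, ouSemigroup β t ψ x * (g x - T x) ∂(gaussMeasure β) := by
    simp only [mul_sub]
    rw [integral_sub (bdd hψm hψ1 hTg) (bdd hψm hψ1 h0),
      integral_sub (bdd hTψm hTψ1 hg) (bdd hTψm hTψ1 hTi),
      integral_mul_ouSemigroup hβ ht hg hgm hψm hψ1]
    ring
  have e2 : ∫ x, ouSemigroup β t ψ x * (g x - T x) ∂(gaussMeasure β) ≤
      ∫ x, |g x - T x| ∂(gaussMeasure β) := by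
    refine integral_mono (bdd hTψm hTψ1 (hg.sub hTi)) (hg.sub hTi).abs fun x => ?_
    refine (le_abs_self _).trans ?_
    rw [abs_mul]
    exact mul_le_of_le_one_left (abs_nonneg _) (hTψ1 x)
  have e3 := (le_abs_self _).trans
    (abs_integral_inverse_expansion_sub_le hβ hK hf hB hψ hψ1 ht)
  show ∫ x, ψ x * (ouSemigroup β t g x - f 0 x) ∂(gaussMeasure β) ≤ _
  rw [e1]
  exact add_le_add e3 e2

/-- All the terms `Bᵏ u`, `k ≥ 1`, have zero mass, mean and second moment: `B` maps the span of
`1, x, x²` to that of `x, 1 - β x²`, against which a normalized density integrates to zero. -/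
theorem integral_iterate_generator_moments (hβ : 0 < β) {K : ℕ} {f : ℕ → ℝ → ℝ}
    (hf : ∀ k < K, SmoothAllMoments β (f k)) (hB : ∀ k < K, f (k + 1) = ouGenerator β (f k))
    (hu : IsNormalizedDensity β (f 0)) {k : ℕ} (hk : k < K) :
    ∫ x, f (k + 1) x ∂(gaussMeasure β) = 0 ∧ ∫ x, x * f (k + 1) x ∂(gaussMeasure β) = 0 ∧
      ∫ x, x ^ 2 * f (k + 1) x ∂(gaussMeasure β) = 0 := by
  induction k with
  | zero =>
    rw [hB 0 hk]
    refine ⟨integral_ouGenerator_eq_zero hβ (hf 0 hk), ?_, ?_⟩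
    · rw [integral_id_mul_ouGenerator hβ (hf 0 hk), hu.integral_id_mul, mul_zero]
    · rw [integral_sq_mul_ouGenerator hβ (hf 0 hk), hu.integral_eq_one, hu.integral_sq_mul,
        mul_one_div_cancel hβ.ne', sub_self]
  | succ k ih =>
    obtain ⟨i0, i1, i2⟩ := ih (by omega)
    rw [hB (k + 1) hk]
    refine ⟨integral_ouGenerator_eq_zero hβ (hf _ hk), ?_, ?_⟩
    · rw [integral_id_mul_ouGenerator hβ (hf _ hk), i1, mul_zero]
    · rw [integral_sq_mul_ouGenerator hβ (hf _ hk), i0, i2, mul_zero, sub_zero]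

/-- The truncated exponential series of `-tB` applied to `u` is replaced by a normalized density
comparable with `u`: its relative deviation from `u` is cut off where it is not small, and the
resulting error in the first three moments is corrected on `[-1, 1]`. Both operations cost
`O(t ^ K)` in `L¹`. -/
theorem exists_normalizedDensity_near_expansion (hβ : 0 < β) {K : ℕ} (hK : 1 ≤ K)
    {u : ℝ → ℝ} {P : ℕ → ℝ → ℝ} (hP0 : P 0 = fun _ => 1)
    (hf : ∀ k < K, SmoothAllMoments β fun x => P k x * u x)
    (hB : ∀ k < K, (fun x => P (k + 1) x * u x) = ouGenerator β fun x => P k x * u x)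
    (hu : IsNormalizedDensity β u) (hPm : ∀ k < K, Measurable (P k))
    {A : ℝ} (hA : 0 ≤ A) {m : ℕ}
    (hPb : ∀ k < K, ∀ x, |P k x| ≤ A * (1 + x ^ 2) ^ m) {S : ℝ}
    (hS : ∫ x, (1 + x ^ 2) ^ (m + 1 + 2 * K * m) * u x ∂(gaussMeasure β) ≤ S) {C₁ : ℝ}
    (hC₁ : 0 ≤ C₁)
    (hcor : ∀ e₀ e₁ e₂ η : ℝ, |e₀| ≤ η → |e₁| ≤ η → |e₂| ≤ η →
        ∃ ψ : ℝ → ℝ, Measurable ψ ∧ (∀ x, |ψ x| ≤ C₁ * η) ∧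
          ∫ x, ψ x * u x ∂(gaussMeasure β) = e₀ ∧
          ∫ x, x * (ψ x * u x) ∂(gaussMeasure β) = e₁ ∧
          ∫ x, x ^ 2 * (ψ x * u x) ∂(gaussMeasure β) = e₂)
    {t : ℝ} (ht0 : 0 ≤ t) (ht1 : t ≤ 1) (htα : (K * A + C₁ * (K * A * S)) * √t ≤ 1 / 3) :
    ∃ g : ℝ → ℝ, IsNormalizedDensity β g ∧ (∀ x, 2 / 3 * u x ≤ g x ∧ g x ≤ 4 / 3 * u x) ∧
      ∫ x, |g x - ∑ k ∈ Finset.range K, (-t) ^ k / k.factorial * (P k x * u x)|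
        ∂(gaussMeasure β) ≤ (C₁ * (K * A * S) + K * A * S) * t ^ K := by
  obtain ⟨L, rfl⟩ : ∃ L, K = L + 1 := ⟨K - 1, by omega⟩
  have hmu : HasAllMoments β u := by simpa [hP0] using (hf 0 (by omega)).moments
  have hs0 : 0 ≤ √t := Real.sqrt_nonneg t
  have hs1 : √t ≤ 1 := Real.sqrt_le_one.2 ht1
  have hss : √t * √t = t := Real.mul_self_sqrt ht0
  have hS0 : 0 ≤ S := le_trans (integral_nonneg fun x =>
    mul_nonneg (by positivity) (hu.nonneg x)) hS
  set κ : ℝ := ((L + 1 : ℕ) : ℝ) * A with hκ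
  have hκ0 : 0 ≤ κ := by positivity
  -- `u (1 + Q)` is the truncated series
  set Q : ℝ → ℝ := fun x => ∑ k ∈ Finset.range L, (-t) ^ (k + 1) / (k + 1).factorial * P (k + 1) x
    with hQ
  have hQm : Measurable Q := Finset.measurable_sum _ fun k hk =>
    (hPm (k + 1) (by have := Finset.mem_range.1 hk; omega)).const_mul _
  have hsum : ∀ x, ∑ k ∈ Finset.range (L + 1), (-t) ^ k / k.factorial * (P k x * u x) =
      (1 + Q x) * u x := fun x => by
    rw [Finset.sum_range_succ', add_comm, add_mul, hQ, Finset.sum_mul]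
    simp [hP0, mul_assoc]
  have hQb : ∀ x, |Q x| ≤ κ * (t * (1 + x ^ 2) ^ m) := fun x => by
    have hterm : ∀ k ∈ Finset.range L, |(-t) ^ (k + 1) / (k + 1).factorial * P (k + 1) x| ≤
        t * (A * (1 + x ^ 2) ^ m) := fun k hk => by
      rw [abs_mul, abs_div, abs_pow, abs_neg, abs_of_nonneg ht0, Nat.abs_cast]
      refine mul_le_mul ?_ (hPb (k + 1) (by have := Finset.mem_range.1 hk; omega) x)
        (abs_nonneg _) ht0
      have h1 : t ^ (k + 1) ≤ t := by simpa using pow_le_pow_of_le_one ht0 ht1 (Nat.le_add_left 1 k)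
      have h2 : (1 : ℝ) ≤ (k + 1).factorial := by exact_mod_cast (k + 1).factorial_pos
      exact (div_le_self (by positivity) h2).trans h1
    calc |Q x| ≤ ∑ _k ∈ Finset.range L, t * (A * (1 + x ^ 2) ^ m) :=
          (Finset.abs_sum_le_sum_abs _ _).trans (Finset.sum_le_sum hterm)
      _ = L * (t * (A * (1 + x ^ 2) ^ m)) := by simp
      _ ≤ (L + 1 : ℕ) * (t * (A * (1 + x ^ 2) ^ m)) := by gcongr; omega
      _ = _ := by rw [hκ]; ring
  -- `W` is the part of `Q` to be cut off; on its support `1 ≤ t ^ K (1 + x²) ^ (2 K m)`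
  set E : Set ℝ := {x | 1 < √t * (1 + x ^ 2) ^ m} with hE
  have hEm : MeasurableSet E := measurableSet_lt measurable_const (by fun_prop)
  set W : ℝ → ℝ := E.indicator Q with hW
  have hWm : Measurable W := hQm.indicator hEm
  have hWb : ∀ x, |W x| ≤ κ * t ^ (L + 1) * (1 + x ^ 2) ^ (m + 2 * (L + 1) * m) := fun x => by
    by_cases hx : x ∈ E
    · rw [hW, Set.indicator_of_mem hx]
      have h1 : 1 ≤ (√t * (1 + x ^ 2) ^ m) ^ (2 * (L + 1)) := one_le_pow₀ (le_of_lt hx)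
      have h2 : (√t * (1 + x ^ 2) ^ m) ^ (2 * (L + 1)) =
          t ^ (L + 1) * (1 + x ^ 2) ^ (2 * (L + 1) * m) := by
        rw [mul_pow, pow_mul, Real.sq_sqrt ht0, ← pow_mul, mul_comm m]
      rw [h2] at h1
      have hm0 : 0 ≤ (1 + x ^ 2) ^ m := by positivity
      calc |Q x| ≤ κ * (t * (1 + x ^ 2) ^ m) := hQb x
        _ ≤ κ * (1 * (1 + x ^ 2) ^ m) := by gcongr
        _ ≤ κ * ((t ^ (L + 1) * (1 + x ^ 2) ^ (2 * (L + 1) * m)) * (1 + x ^ 2) ^ m) := by gcongr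
        _ = _ := by rw [pow_add]; ring
    · rw [hW, Set.indicator_of_notMem hx, abs_zero]
      positivity
  have hQW : ∀ x, |Q x - W x| ≤ κ * √t := fun x => by
    by_cases hx : x ∈ E
    · rw [hW, Set.indicator_of_mem hx, sub_self, abs_zero]; positivity
    · rw [hW, Set.indicator_of_notMem hx, sub_zero]
      calc |Q x| ≤ κ * (t * (1 + x ^ 2) ^ m) := hQb x
        _ = κ * (√t * (√t * (1 + x ^ 2) ^ m)) := by rw [← mul_assoc √t, hss]
        _ ≤ κ * (√t * 1) := by gcongr; exact not_lt.1 hx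
        _ = _ := by rw [mul_one]
  have hQmom := hmu.mul hQm (A := κ * t) (m := m) fun x => (hQb x).trans_eq (by ring)
  have hWmom := hmu.mul hWm hWb
  have hWint : ∀ w : ℝ → ℝ, Measurable w → (∀ x, |w x| ≤ 1 * (1 + x ^ 2) ^ 1) →
      ∫ x, |w x * (W x * u x)| ∂(gaussMeasure β) ≤ κ * S * t ^ (L + 1) := fun w hw hwb => by
    have hI := hmu.integrable (m + 1 + 2 * (L + 1) * m)
    calc _ ≤ ∫ x, κ * t ^ (L + 1) * ((1 + x ^ 2) ^ (m + 1 + 2 * (L + 1) * m) * u x)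
          ∂(gaussMeasure β) := by
          refine integral_mono (hWmom.mul hw hwb).integrable_self.abs (hI.const_mul _) fun x => ?_
          simp only [abs_mul, abs_of_nonneg (hu.nonneg x)]
          calc |w x| * (|W x| * u x) ≤ 1 * (1 + x ^ 2) ^ 1 *
                (κ * t ^ (L + 1) * (1 + x ^ 2) ^ (m + 2 * (L + 1) * m) * u x) :=
                mul_le_mul (hwb x) (mul_le_mul_of_nonneg_right (hWb x) (hu.nonneg x))
                  (mul_nonneg (abs_nonneg _) (hu.nonneg x)) (by positivity)
            _ = _ := by ring
      _ ≤ κ * t ^ (L + 1) * S := by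
          rw [integral_const_mul]; gcongr
      _ = _ := by ring
  have b0 : ∀ x : ℝ, |(1 : ℝ)| ≤ 1 * (1 + x ^ 2) ^ 1 := fun x => by simpa using sq_nonneg x
  have b1 : ∀ x : ℝ, |x| ≤ 1 * (1 + x ^ 2) ^ 1 := fun x => by simpa using abs_le_one_add_sq x
  have b2 : ∀ x : ℝ, |x ^ 2| ≤ 1 * (1 + x ^ 2) ^ 1 := fun x => by simp
  obtain ⟨ψ, hψm, hψb, hψ0, hψ1, hψ2⟩ := hcor (∫ x, 1 * (W x * u x) ∂(gaussMeasure β))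
    (∫ x, x * (W x * u x) ∂(gaussMeasure β)) (∫ x, x ^ 2 * (W x * u x) ∂(gaussMeasure β))
    (κ * S * t ^ (L + 1))
    (abs_integral_le_integral_abs.trans (hWint (fun _ => 1) measurable_const b0))
    (abs_integral_le_integral_abs.trans (hWint (fun x => x) measurable_id b1))
    (abs_integral_le_integral_abs.trans (hWint (fun x => x ^ 2) (by fun_prop) b2))
  have hψmom := hmu.mul hψm (A := C₁ * (κ * S * t ^ (L + 1))) (m := 0)
    (fun x => (hψb x).trans_eq (by ring))
  set g : ℝ → ℝ := fun x => u x + Q x * u x - W x * u x + ψ x * u x with hg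
  have hum := hu.measurable
  have hgm : Measurable g := by fun_prop
  have hdev : ∀ x, |Q x - W x + ψ x| ≤ 1 / 3 := fun x => by
    refine (abs_add_le _ _).trans ((add_le_add (hQW x) (hψb x)).trans (le_trans ?_ htα))
    have h1 : t ^ (L + 1) ≤ √t := by
      calc t ^ (L + 1) ≤ t ^ 1 := pow_le_pow_of_le_one ht0 ht1 (by omega)
        _ = √t * √t := by rw [pow_one, hss]
        _ ≤ √t * 1 := by gcongr
        _ = √t := mul_one _
    rw [add_mul, mul_assoc C₁]
    gcongr
  have hgb : ∀ x, 2 / 3 * u x ≤ g x ∧ g x ≤ 4 / 3 * u x := fun x => by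
    have h1 := abs_le.1 (hdev x)
    have h2 := hu.nonneg x
    have h3 : g x = u x + (Q x - W x + ψ x) * u x := by simp only [hg]; ring
    rw [h3]
    constructor <;> nlinarith
  have hmoments := @integral_iterate_generator_moments β hβ (L + 1) (fun k x => P k x * u x) hf hB
    (by simpa [hP0] using hu)
  have hmom : ∀ w : ℝ → ℝ, Measurable w → (∀ x, |w x| ≤ 1 * (1 + x ^ 2) ^ 1) →
      (∀ k < L, ∫ x, w x * (P (k + 1) x * u x) ∂(gaussMeasure β) = 0) →
      ∫ x, w x * (ψ x * u x) ∂(gaussMeasure β) = ∫ x, w x * (W x * u x) ∂(gaussMeasure β) →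
      ∫ x, w x * g x ∂(gaussMeasure β) = ∫ x, w x * u x ∂(gaussMeasure β) :=
    fun w hw hwb hz hψW => by
    have hQz : ∫ x, w x * (Q x * u x) ∂(gaussMeasure β) = 0 := by
      have e : ∀ x, w x * (Q x * u x) = ∑ k ∈ Finset.range L,
          (-t) ^ (k + 1) / (k + 1).factorial * (w x * (P (k + 1) x * u x)) := fun x => by
        rw [hQ, Finset.sum_mul, Finset.mul_sum]
        exact Finset.sum_congr rfl fun k _ => by ring
      simp only [e]
      rw [integral_finsetSum _ fun k hk => ?_]
      · refine Finset.sum_eq_zero fun k hk => ?_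
        rw [integral_const_mul, hz k (Finset.mem_range.1 hk), mul_zero]
      · exact ((hf (k + 1) (by have := Finset.mem_range.1 hk; omega)).moments.mul hw
          hwb).integrable_self.const_mul _
    have iu := (hmu.mul hw hwb).integrable_self
    have iQ := (hQmom.mul hw hwb).integrable_self
    have iW := (hWmom.mul hw hwb).integrable_self
    have iψ := (hψmom.mul hw hwb).integrable_self
    have e : ∀ x, w x * g x = w x * u x + w x * (Q x * u x) - w x * (W x * u x) +
        w x * (ψ x * u x) := fun x => by simp only [hg]; ring
    simp only [e]
    have i2 : Integrable (fun x => w x * u x + w x * (Q x * u x)) (gaussMeasure β) := iu.add iQ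
    have i3 : Integrable (fun x => w x * u x + w x * (Q x * u x) - w x * (W x * u x))
        (gaussMeasure β) := i2.sub iW
    rw [integral_add i3 iψ, integral_sub i2 iW, integral_add iu iQ, hQz, hψW]
    ring
  have hgi : HasAllMoments β g := by
    have := ((hmu.add hQmom).add (hWmom.const_mul (-1))).add hψmom
    have e : g = fun x => u x + Q x * u x + -1 * (W x * u x) + ψ x * u x := by
      funext x; simp only [hg]; ring
    rw [e]
    exact this
  refine ⟨g, IsNormalizedDensity.of_moments hgm
    (fun x => le_trans (mul_nonneg (by norm_num) (hu.nonneg x)) (hgb x).1) hgi.integrable_self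
    (hgi.mul (by fun_prop) b2).integrable_self ?_ ?_ ?_, hgb, ?_⟩
  · have := hmom (fun _ => 1) measurable_const b0
      (fun k hk => by simpa using (hmoments (Nat.lt_succ_of_lt hk)).1) (by simpa using hψ0)
    simpa [hu.integral_eq_one] using this
  · exact (hmom (fun x => x) measurable_id b1
      (fun k hk => (hmoments (Nat.lt_succ_of_lt hk)).2.1) hψ1).trans hu.integral_id_mul
  · exact (hmom (fun x => x ^ 2) (by fun_prop) b2
      (fun k hk => (hmoments (Nat.lt_succ_of_lt hk)).2.2) hψ2).trans hu.integral_sq_mul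
  · have hle : ∀ x, |g x - ∑ k ∈ Finset.range (L + 1), (-t) ^ k / k.factorial * (P k x * u x)| ≤
        C₁ * (κ * S * t ^ (L + 1)) * u x + |1 * (W x * u x)| := fun x => by
      have e : g x - (1 + Q x) * u x = ψ x * u x + -(1 * (W x * u x)) := by
        simp only [hg]; ring
      rw [hsum, e]
      refine (abs_add_le _ _).trans ?_
      rw [abs_neg, abs_mul (ψ x), abs_of_nonneg (hu.nonneg x)]
      gcongr
      exacts [hu.nonneg x, hψb x]
    have hWi : Integrable (fun x => |1 * (W x * u x)|) (gaussMeasure β) := by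
      simpa using hWmom.integrable_self.abs
    have hTi : Integrable (fun x => g x - ∑ k ∈ Finset.range (L + 1),
        (-t) ^ k / k.factorial * (P k x * u x)) (gaussMeasure β) :=
      hgi.integrable_self.sub (integrable_finsetSum _ fun k hk =>
        (hf k (Finset.mem_range.1 hk)).moments.integrable_self.const_mul _)
    have h1 := integral_mono hTi.abs ((hu.integrable.const_mul _).add hWi) hle
    simp only [Pi.add_apply] at h1
    rw [integral_add (hu.integrable.const_mul _) hWi, integral_const_mul, hu.integral_eq_one] at h1
    have h2 := hWint (fun _ => 1) measurable_const b0
    calc _ ≤ _ := h1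
      _ ≤ C₁ * (κ * S * t ^ (L + 1)) * 1 + κ * S * t ^ (L + 1) := by gcongr
      _ = _ := by ring

/-! ### Uniformity over the class of potentials -/

/-- The potentials of class `C^(2K)` all of whose derivatives of orders `1, …, 2K` are bounded by
`C₁ (1 + x²) ^ C₂`. -/
def potentialClass (K : ℕ) (C₁ C₂ : ℝ) : Set (ℝ → ℝ) :=
  {V | ContDiff ℝ (2 * K : ℕ) V ∧
    ∀ x, ∑ j ∈ Finset.Icc 1 (2 * K), |iteratedDeriv j V x| ≤ C₁ * (1 + x ^ 2) ^ C₂}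

/-- Uniform polynomial growth of `V'`, as a consequence of the hypothesis with a real exponent. -/
theorem uniformPolyGrowth_deriv_of_sum_le {K : ℕ} (hK : 1 ≤ K) (C₁ C₂ : ℝ) :
    UniformPolyGrowth (2 * K - 1) fun V : potentialClass K C₁ C₂ => deriv V.1 := by
  refine UniformPolyGrowth.of_iteratedDeriv (A := |C₁|) (m := ⌈C₂⌉₊) (fun V => ?_)
    fun j hj V x => ?_
  · have h : ContDiff ℝ ((2 * K - 1 : ℕ) + 1) V.1 := by
      have h2 := V.2.1
      rwa [show (2 * K : ℕ) = (2 * K - 1) + 1 by omega, Nat.cast_succ] at h2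
    exact (contDiff_succ_iff_deriv.1 h).2.2
  · rw [← iteratedDeriv_succ']
    have h1 : (1 : ℝ) ≤ 1 + x ^ 2 := by nlinarith [sq_nonneg x]
    calc |iteratedDeriv (j + 1) V.1 x|
        ≤ ∑ i ∈ Finset.Icc 1 (2 * K), |iteratedDeriv i V.1 x| :=
          Finset.single_le_sum (f := fun i => |iteratedDeriv i V.1 x|)
            (fun i _ => abs_nonneg _) (Finset.mem_Icc.2 ⟨by omega, by omega⟩)
      _ ≤ C₁ * (1 + x ^ 2) ^ C₂ := V.2.2 x
      _ ≤ |C₁| * (1 + x ^ 2) ^ ⌈C₂⌉₊ := by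
          rw [← Real.rpow_natCast (1 + x ^ 2)]
          exact mul_le_mul (le_abs_self _) (Real.rpow_le_rpow_of_exponent_le h1 (Nat.le_ceil C₂))
            (by positivity) (abs_nonneg _)

/-- Finitely many uniform polynomial bounds can be replaced by a single one. -/
theorem UniformPolyGrowth.exists_common_bound {ι : Type*} {K : ℕ} {r : ℕ → ℕ}
    {P : ℕ → ι → ℝ → ℝ} (h : ∀ k ≤ K, UniformPolyGrowth (r k) (P k)) :
    ∃ A : ℝ, 0 ≤ A ∧ ∃ m : ℕ, ∀ k ≤ K, ∀ i x, |P k i x| ≤ A * (1 + x ^ 2) ^ m := by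
  induction K with
  | zero =>
    obtain ⟨A, hA, m, hb⟩ := (h 0 le_rfl).exists_bound
    exact ⟨A, hA, m, fun k hk => by obtain rfl := Nat.le_zero.1 hk; exact hb⟩
  | succ K ih =>
    obtain ⟨A, hA, m, hb⟩ := ih fun k hk => h k (hk.trans (Nat.le_succ K))
    obtain ⟨B, hB, n, hb'⟩ := (h (K + 1) le_rfl).exists_bound
    refine ⟨A + B, add_nonneg hA hB, m + n, fun k hk i x => ?_⟩
    have h1 : (1 : ℝ) ≤ 1 + x ^ 2 := by nlinarith [sq_nonneg x]
    rcases Nat.le_succ_iff.1 hk with hk | rfl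
    · exact (hb k hk i x).trans (by gcongr <;> linarith)
    · exact (hb' i x).trans (by gcongr <;> linarith)

end

theorem proposition6p1 (β : ℝ) (hβ : 0 < β) (K : ℕ) (hK : 1 ≤ K)
    (C₁ C₂ δ₀ a M : ℝ) (hδ₀ : 0 < δ₀) (ha : 0 < a) :
    ∃ α > 0, ∃ C > 0, ∃ D : ℝ → ℝ, (∀ c, 0 < D c) ∧
      ∀ u V : ℝ → ℝ, (∀ x, u x = Real.exp (-V x)) →
        IsNormalizedDensity β u →
        ContDiff ℝ (2 * K : ℕ) V →
        (∀ x, ∑ j ∈ Finset.Icc 1 (2 * K), |iteratedDeriv j V x| ≤ C₁ * (1 + x ^ 2) ^ C₂) →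
        Integrable (fun x => Real.exp (δ₀ * |x| ^ a)) (densityMeasure β u) →
        ∫ x, Real.exp (δ₀ * |x| ^ a) ∂(densityMeasure β u) ≤ M →
        ∀ t : ℝ, 0 ≤ t → t ≤ α →
          ∃ g : ℝ → ℝ, IsNormalizedDensity β g ∧
            (Integrable (fun x => |ouSemigroup β t g x - u x|) (gaussMeasure β) ∧
              ∫ x, |ouSemigroup β t g x - u x| ∂(gaussMeasure β) ≤ C * t ^ K) ∧
            (∀ c > 0,
              (LogSobolev (densityMeasure β u) c → LogSobolev (densityMeasure β g) (2 * c)) ∧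
              (LogSobolev (densityMeasure β g) c → LogSobolev (densityMeasure β u) (2 * c))) ∧
            ∀ (c : ℝ) (n N : ℕ), (n : ℝ) ≤ c * (N : ℝ) ^ 2 →
              Integrable (fun x => |ouSemigroupPi β t (tensorPow n g) x - tensorPow n u x|)
                (Measure.pi fun _ : Fin n => gaussMeasure β) ∧
              ∫ x, |ouSemigroupPi β t (tensorPow n g) x - tensorPow n u x|
                ∂(Measure.pi fun _ : Fin n => gaussMeasure β) ≤ D c * (N : ℝ) ^ 2 * t ^ K := by
  have hV := uniformPolyGrowth_deriv_of_sum_le hK C₁ C₂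
  have hP : ∀ k ≤ K, UniformPolyGrowth (2 * K - 2 * k) fun V : potentialClass K C₁ C₂ =>
      genFactor β V.1 k := fun k hk => hV.genFactor β hK hk
  obtain ⟨A, hA, m, hPb⟩ := UniformPolyGrowth.exists_common_bound
    (P := fun k (V : potentialClass K C₁ C₂) => genFactor β V.1 k) hP
  obtain ⟨B, hB, l, hVb⟩ := hV.exists_bound
  obtain ⟨S, hS0, hS⟩ := exists_moment_bound β hδ₀ ha M (m + 1 + 2 * K * m)
  obtain ⟨S', hS0', hS'⟩ := exists_moment_bound β hδ₀ ha M m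
  obtain ⟨κ, hκ, hlow⟩ := exists_lower_bound hβ hB l
  obtain ⟨E, hE, hcor⟩ := exists_moment_corrector hβ hκ
  -- for `√t ≤ 1 / Γ` the relative deviation of `g` from `u` is at most `1 / 3`
  set Γ : ℝ := 3 * (K * A + E * (K * A * S)) + 1 with hΓ
  have hΓ1 : 1 ≤ Γ := by
    have : 0 ≤ 3 * (K * A + E * (K * A * S)) := by positivity
    linarith
  have hΓ0 : 0 < Γ := zero_lt_one.trans_le hΓ1
  -- the error of the series, plus the costs of the moment correction and of the cut-off
  set C : ℝ := A * S' + (E * (K * A * S) + K * A * S) + 1 with hC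
  have hC0 : 0 < C := by positivity
  refine ⟨(Γ ^ 2)⁻¹, by positivity, C, hC0, fun c => C * (|c| + 1), fun c => by positivity, ?_⟩
  intro u V huV hu hVc hVs hexp hM t ht0 htα
  obtain rfl : u = fun x => Real.exp (-V x) := funext huV
  set u : ℝ → ℝ := fun x => Real.exp (-V x) with hudef
  have hmom : HasAllMoments β u :=
    ⟨hu.measurable, fun p => ((exists_moment_bound β hδ₀ ha M p).choose_spec.2 u hu hexp hM).1⟩
  have h2K : 2 ≤ 2 * K := by omega
  have hVc2 : ContDiff ℝ 2 V := hVc.of_le (by exact_mod_cast h2K)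
  have hf : ∀ k < K, SmoothAllMoments β fun x => genFactor β V k x * u x := fun k hk =>
    SmoothAllMoments.mul_exp_neg (hV.mono (by omega)) ((hP k hk.le).mono (by omega))
      ⟨V, hVc, hVs⟩ hVc2 hmom
  have hgen : ∀ k < K, (fun x => genFactor β V (k + 1) x * u x) =
      ouGenerator β fun x => genFactor β V k x * u x := fun k hk =>
    (ouGenerator_mul_exp_neg β hVc2
      (((hP k hk.le).mono (s := 2) (by omega)).contDiff ⟨V, hVc, hVs⟩)).symm
  have hPm : ∀ k ≤ K, Measurable (genFactor β V k) := fun k hk =>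
    ((hP k hk).continuous ⟨V, hVc, hVs⟩).measurable
  have hPb' : ∀ k ≤ K, ∀ x, |genFactor β V k x| ≤ A * (1 + x ^ 2) ^ m := fun k hk =>
    hPb k hk ⟨V, hVc, hVs⟩
  have ht1 : t ≤ 1 := htα.trans (inv_le_one_of_one_le₀ (one_le_pow₀ hΓ1))
  have hsqrt : √t ≤ Γ⁻¹ := Real.sqrt_le_iff.2 ⟨by positivity, by rwa [inv_pow]⟩
  have hsmall : (K * A + E * (K * A * S)) * √t ≤ 1 / 3 := by
    calc (K * A + E * (K * A * S)) * √t ≤ (Γ / 3) * Γ⁻¹ := by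
          gcongr
          rw [hΓ]; linarith
      _ = 1 / 3 := by field_simp
  obtain ⟨g, hg, hgb, hgL⟩ := exists_normalizedDensity_near_expansion hβ hK
    (P := genFactor β V) rfl hf hgen hu (fun k hk => hPm k hk.le) hA
    (fun k hk => hPb' k hk.le) (hS u hu hexp hM).2 hE
    (hcor u hu.measurable (hlow V hu (hVc2.differentiable (by norm_num)) (hVb ⟨V, hVc, hVs⟩)))
    ht0 ht1 hsmall
  have hTg := integrable_ouSemigroup hβ ht0 hg.integrable hg.measurable
  have hL1 : ∫ x, |ouSemigroup β t g x - u x| ∂(gaussMeasure β) ≤ C * t ^ K := by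
    have h1 := integral_abs_ouSemigroup_sub_le hβ hK hf hgen hg.integrable hg.measurable ht0
    have h2 : ∫ x, |genFactor β V K x * u x| ∂(gaussMeasure β) ≤ A * S' := by
      obtain ⟨i1, i2⟩ := hS' u hu hexp hM
      refine (integral_mono (hmom.mul (hPm K le_rfl) (hPb' K le_rfl)).integrable_self.abs
        (i1.const_mul A) fun x => ?_).trans ?_
      · simp only [abs_mul, abs_of_nonneg (hu.nonneg x)]
        rw [← mul_assoc]
        exact mul_le_mul_of_nonneg_right (hPb' K le_rfl x) (hu.nonneg x)
      · rw [integral_const_mul]; gcongr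
    simp only [genFactor, one_mul] at h1
    calc _ ≤ _ := h1
      _ ≤ t ^ K * (A * S') + (E * (K * A * S) + K * A * S) * t ^ K := by gcongr
      _ ≤ t ^ K * (A * S') + (E * (K * A * S) + K * A * S) * t ^ K + t ^ K :=
          le_add_of_nonneg_right (by positivity)
      _ = C * t ^ K := by rw [hC]; ring
  refine ⟨g, hg, ⟨(hTg.sub hu.integrable).abs, hL1⟩, fun c hc => ?_, fun c n N hn => ?_⟩
  · have := hu.isProb
    have := hg.isProb
    have l1 : densityMeasure β g ≤ (4 / 3 : NNReal) • densityMeasure β u :=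
      densityMeasure_le_smul hu.measurable fun x => by simpa using (hgb x).2
    have l2 : densityMeasure β u ≤ (3 / 2 : NNReal) • densityMeasure β g :=
      densityMeasure_le_smul hg.measurable fun x => by
        have := (hgb x).1
        push_cast
        linarith
    constructor
    · exact LogSobolev.of_le_smul l1 l2 hc (by push_cast; linarith)
    · exact LogSobolev.of_le_smul l2 l1 hc (by push_cast; linarith)
  · simp only [ouSemigroupPi_tensorPow]
    obtain ⟨i, hle⟩ := integral_abs_prod_sub_prod_le (n := n) hTg hu.integrable
      (ouSemigroup_nonneg hg.nonneg) hu.nonneg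
      ((integral_ouSemigroup hβ ht0 hg.integrable hg.measurable).trans hg.integral_eq_one)
      hu.integral_eq_one
    refine ⟨i, hle.trans ?_⟩
    have hn' : (n : ℝ) ≤ (|c| + 1) * (N : ℝ) ^ 2 :=
      hn.trans (by gcongr; linarith [le_abs_self c])
    calc n * ∫ x, |ouSemigroup β t g x - u x| ∂(gaussMeasure β)
        ≤ (|c| + 1) * (N : ℝ) ^ 2 * (C * t ^ K) := by gcongr
      _ = _ := by ring
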